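/- Let $n,k\ge 0$. Let $A_n$ be the Coxeter group with generators $s_1,\dots,s_n$ (with $m_{ii}=1$, $m_{ij}=3$ if $|i-j|=1$, $m_{ij}=2$ if $|i-j|>1$), contained in the Coxeter group $C_{n+1}$ with generators $s_0,s_1,\dots,s_n$ (same $m_{ij}$, except that $m_{01}=m_{10}=4$). In $C_{n+1}$ put $s_{-i}=s_i$ for $1\le i\le n$, and call $s_{-i}$ barred. Let $\omega\in A_n$. A reduced signed increasing factorization of $\omega$ into $k$ parts is an expression for $\omega$ in the generators $s_{-n},\dots,s_{-1},s_0,s_1,\dots,s_n$ of minimal length among all such expressions, together with a subdivision of it into $k$ consecutive (possibly empty) parts, each increasing for the order $s_{-n}<\cdots<s_{-1}<s_0<s_1<\cdots<s_n$. Write $RSIF_k(\omega)$ for the set of these. The double weight of $v\in RSIF_k(\omega)$ is the pair $(X,Y)\in\mathbb Z_{\ge0}^k\times\mathbb Z_{\ge 0}^k$, where $X_l$ (resp. $Y_l$) is the number of generators of negative (resp. nonnegative) index in the $l$-th part of $v$. Tableaux have partition shape and are drawn in English notation. An Edelman–Greene tableau for $\omega$ is a tableau with entries in $\{1,\dots,n\}$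 whose rows and columns are strictly increasing and whose entries, read by rows, left to right, from the bottom row to the top row, are the indices of a reduced word for $\omega$ in $s_1,\dots,s_n$. A primed tableau is a tableau with entries in $1'<1<2'<2<\cdots<k'<k$ whose rows and columns are weakly increasing, with at most one $i'$ in each row and at most one $i$ in each column, for every $i$. Its double weight is $(X,Y)$, where $X_i$ is the number of entries $i'$ and $Y_i$ the number of entries $i$. Edelman–Greene insertion of $x$ into a row: if no entry of the row exceeds $x$, append $x$ to the row and stop; otherwise let $y$ be the leftmost entry exceeding $x$; if $y=x+1$ and $x$ is in the row, leave the row unchanged, and otherwise replace $y$ by $x$; in both cases insert $y$ into the next row. Insertion into a tableau starts with the top row. The primed-recording Edelman–Greene map sends $v\in RSIF_k(\omega)$ to the pair $(P,Q)$, where $P$ is obtained from the empty tableau by successively inserting $|i|$ for the generators $s_i$ of $v$ from left to right, and $Q$ is obtained by recording, in the position of the box that the insertion of a generator of the $l$-th part adds to $P$, the entry $l'$ if that generator is barred and $l$ if it is not. Theorem. The primed-recording Edelman–Greene map is a bijection from $RSIF_k(\omega)$ onto the set of pairs $(P,Q)$ where $P$ is an Edelman–Greene tableau for $\omega$ and $Q$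 is a primed tableau of the same shape as $P$. It preserves the double weight: if $v\mapsto(P,Q)$, then the double weight of $Q$ equals the double weight of $v$. -/

import Mathlib

namespace PrimedEG

/-! ### Coxeter groups, reduced words and signed factorizations -/

/-- The Coxeter matrix of type `C_{n+1}`, with generators `s_0, s_1, …, s_n`, the double bond being
between `s_0` and `s_1`. -/
def coxeterC (n : ℕ) : CoxeterMatrix (Fin (n + 1)) where
  M := Matrix.of fun i j : Fin (n + 1) ↦
    if i = j then 1
    else if (i : ℕ) + 1 = j ∨ (j : ℕ) + 1 = i then (if i = 0 ∨ j = 0 then 4 else 3)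
    else 2
  isSymm := by
    ext i j
    simp only [Matrix.transpose_apply, Matrix.of_apply, eq_comm (a := j) (b := i),
      or_comm (a := (j : ℕ) + 1 = i), or_comm (a := j = 0)]
  diagonal := by simp
  off_diagonal := by
    intro i j h
    simp only [Matrix.of_apply, if_neg h]
    split_ifs <;> simp

/-- The inclusion of the Coxeter group `A_n` into `C_{n+1}`. Mathlib numbers the generators of
`A_n` by `Fin n`, so that `i : Fin n` is the index of `s_{i+1}`. -/
noncomputable def inclAC (n : ℕ) : (CoxeterMatrix.A n).Group →* (coxeterC n).Group :=
  (CoxeterMatrix.A n).toCoxeterSystem.lift ⟨fun i ↦ (coxeterC n).simple i.succ, by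
    intro i j
    have h : (coxeterC n) i.succ j.succ = (CoxeterMatrix.A n) i j := by
      simp only [coxeterC, CoxeterMatrix.A, Matrix.of_apply, Fin.succ_inj, Fin.succ_ne_zero,
        or_self, if_false, Fin.val_succ, add_left_inj, or_comm (a := (j : ℕ) + 1 = i)]
    rw [← h]
    exact (coxeterC n).toCoxeterSystem.simple_mul_simple_pow i.succ j.succ⟩

/-- `u` is a reduced word for `w` with respect to the generators `s b`, `b : β`: it is an
expression for `w`, and no other expression for `w` in these generators is shorter. -/
def IsReducedWord {β G : Type*} [Group G] (s : β → G) (w : G) (u : List β) : Prop :=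
  (u.map s).prod = w ∧ ∀ u' : List β, (u'.map s).prod = w → u.length ≤ u'.length

/-- The indices `-n, …, -1, 0, 1, …, n` of the signed generators, with their usual order. -/
abbrev SignedIndex (n : ℕ) : Type := Set.Icc (-(n : ℤ)) n

/-- The signed generators of `C_{n+1}`: both `s_i` and `s_{-i}` are the reflection `s_{|i|}`. -/
def signedGen (n : ℕ) (i : SignedIndex n) : (coxeterC n).Group :=
  (coxeterC n).simple ⟨i.1.natAbs, by have := i.2.1; have := i.2.2; omega⟩

/-- The reduced signed increasing factorizations of `w ∈ C_{n+1}` into `k` (possibly empty)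
parts. -/
def RSIF (n k : ℕ) (w : (coxeterC n).Group) : Set (Fin k → List (SignedIndex n)) :=
  {v | IsReducedWord (signedGen n) w (List.ofFn v).flatten ∧ ∀ l, (v l).Pairwise (· < ·)}

/-- The double weight of a factorization: for each part, the number of generators of negative
index, and the number of generators of nonnegative index. -/
def factorizationDoubleWeight {n k : ℕ} (v : Fin k → List (SignedIndex n)) :
    (Fin k → ℕ) × (Fin k → ℕ) :=
  (fun l ↦ (v l).countP fun i ↦ i.1 < 0, fun l ↦ (v l).countP fun i ↦ 0 ≤ i.1)

/-! ### Tableaux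

A tableau is given by the list of its rows, from top to bottom (English notation). -/

/-- The list of row lengths. -/
def shape {α : Type*} (T : List (List α)) : List ℕ := T.map List.length

/-- The rows are nonempty and of weakly decreasing length, so that the shape is a partition. -/
def HasPartitionShape {α : Type*} (T : List (List α)) : Prop :=
  (shape T).Pairwise (· ≥ ·) ∧ ∀ m ∈ shape T, 0 < m

/-- The `j`-th column (`j = 0, 1, …`), from top to bottom. -/
def column {α : Type*} (T : List (List α)) (j : ℕ) : List α := T.filterMap fun R ↦ R[j]?

/-- The entries read by rows, left to right, from the bottom row to the top row. -/
def readingWord {α : Type*} (T : List (List α)) : List α := T.reverse.flatten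

/-- `P` is an Edelman–Greene tableau for `w ∈ A_n`; an entry `i` stands for the generator `s_i`,
`1 ≤ i ≤ n`. -/
def IsEGTableau (n : ℕ) (w : (CoxeterMatrix.A n).Group) (P : List (List ℕ)) : Prop :=
  HasPartitionShape P ∧
  (∀ R ∈ P, R.Pairwise (· < ·)) ∧
  (∀ j, (column P j).Pairwise (· < ·)) ∧
  ∃ u : List (Fin n), u.map (fun i ↦ (i : ℕ) + 1) = readingWord P ∧
    IsReducedWord (CoxeterMatrix.A n).simple w u

/-- The alphabet `1' < 1 < 2' < 2 < ⋯ < k' < k` (letters are numbered from `0`). -/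
abbrev PrimedLetter (k : ℕ) : Type := Fin k ×ₗ Bool

/-- The letter `i'`. -/
def primed {k : ℕ} (i : Fin k) : PrimedLetter k := toLex (i, false)

/-- The letter `i`. -/
def unprimed {k : ℕ} (i : Fin k) : PrimedLetter k := toLex (i, true)

/-- Primed tableaux: rows and columns are weakly increasing, each row has at most one `i'` and
each column at most one `i`, for each `i`. -/
def IsPrimedTableau (k : ℕ) (Q : List (List (PrimedLetter k))) : Prop :=
  HasPartitionShape Q ∧
  (∀ R ∈ Q, R.Pairwise (· ≤ ·)) ∧
  (∀ j, (column Q j).Pairwise (· ≤ ·)) ∧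
  (∀ R ∈ Q, ∀ i : Fin k, R.count (primed i) ≤ 1) ∧
  (∀ j, ∀ i : Fin k, (column Q j).count (unprimed i) ≤ 1)

/-- The double weight of a primed tableau: the numbers of entries `i'` and of entries `i`. -/
def tableauDoubleWeight {k : ℕ} (Q : List (List (PrimedLetter k))) :
    (Fin k → ℕ) × (Fin k → ℕ) :=
  (fun i ↦ Q.flatten.count (primed i), fun i ↦ Q.flatten.count (unprimed i))

/-! ### Edelman–Greene insertion and the primed-recording map -/

/-- Edelman–Greene insertion of `x` into a row: the new row and the letter, if any, to be inserted
into the next row. If no entry exceeds `x`, then `x` is appended. Otherwise let `y` be the leftmost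
entry exceeding `x`. If `y = x + 1` and the row contains `x`, the row is unchanged and `x + 1` is
passed on; otherwise `x` replaces `y` and `y` is passed on. -/
def egRow (R : List ℕ) (x : ℕ) : List ℕ × Option ℕ :=
  match R.find? (fun y ↦ x < y) with
  | none => (R ++ [x], none)
  | some y => if y = x + 1 ∧ x ∈ R then (R, some y) else (R.replace y x, some y)

/-- Edelman–Greene insertion of `x` into a tableau: the new tableau and the index (from `0`) of the
row at whose end the new box is added. -/
def egInsert : List (List ℕ) → ℕ → List (List ℕ) × ℕ
  | [], x => ([[x]], 0)
  | R :: T, x =>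
    match egRow R x with
    | (R', none) => (R' :: T, 0)
    | (R', some y) => (R' :: (egInsert T y).1, (egInsert T y).2 + 1)

/-- Add a box with entry `a` at the end of row `r` (a new row if row `r` is empty). -/
def addBox {α : Type*} : List (List α) → ℕ → α → List (List α)
  | [], _, a => [[a]]
  | R :: T, 0, a => (R ++ [a]) :: T
  | R :: T, r + 1, a => R :: addBox T r a

/-- Insert a letter into the insertion tableau, and record it by the entry `q` in the box of the
recording tableau at the position of the new box. -/
def egStep {α : Type*} (S : List (List ℕ) × List (List α)) (p : ℕ × α) :
    List (List ℕ) × List (List α) :=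
  ((egInsert S.1 p.1).1, addBox S.2 (egInsert S.1 p.1).2 p.2)

/-- The generators of a factorization in order, as pairs consisting of the unsigned index `|i|` and
the recording letter: `l'` if the generator `s_i` of the `l`-th part is barred, and `l` if not. -/
def recordedWord {n k : ℕ} (v : Fin k → List (SignedIndex n)) : List (ℕ × PrimedLetter k) :=
  (List.ofFn fun l ↦ (v l).map fun i ↦
    (i.1.natAbs, if i.1 < 0 then primed l else unprimed l)).flatten

/-- The primed-recording Edelman–Greene map `v ↦ (P, Q)`. -/
def primedRecordingEG {n k : ℕ} (v : Fin k → List (SignedIndex n)) :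
    List (List ℕ) × List (List (PrimedLetter k)) :=
  (recordedWord v).foldl egStep ([], [])

end PrimedEG

/-!
The retraction of `C_{n+1}` onto `A_n` that sends `s_0` to `1` deletes the letters `s_0` of a
word. Hence the reduced words in the signed generators for an element of `A_n` do not contain
`s_0`, and without the signs they are its reduced words in `A_n` (`isReducedWord_signedGen_iff`).
A factorization thus amounts to a reduced word of `A_n` whose letters carry weakly increasing
recording letters, such that generators with the same recording letter `l` increase, and those
with the same recording letter `l'` decrease (`IsRecordedWord`).

For reduced words, Edelman–Greene insertion into a row is one of three explicit moves (`RowIns`),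
each of which changes the reading word by commutation and braid relations only. So the product of
the reading word of the insertion tableau and its length are those of the word inserted, which
keeps all words involved reduced. Strictness of the columns of two adjacent rows `R`, `S` is
expressed by counting: for every `z`, `S` has at most as many entries `≤ z` as `R` has entries
`< z` (`RowAbove`). The change of these counts under a move is simple, which shows that strictness is
preserved by insertion (`egInsert_spec`) and by reverse insertion (`exists_egInsert`); the latter
starts from any removable box, and its result is unique (`egInsert_injective`).

Comparing the letters passed on from row to row shows that inserting an ascent adds the second box
weakly above the first (`egInsert_row_le`), and inserting a descent adds it strictly below
(`egInsert_row_lt`). Therefore the boxes recorded by `l'` form a vertical strip created downwards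
and those recorded by `l` a horizontal strip created from left to right, so that the recording
tableau is a primed tableau. Conversely the box created last can be read off a primed tableau
(`IsLastBox`). Removing it and inserting in reverse, by induction on the number of boxes, inverts
the map (`insertWord_injective`, `exists_insertWord_eq`); the two bumping statements show that the
word obtained is compatible with its recording letters.
-/

namespace PrimedEG

/-! ### Words in the generators of `A_n` -/

/-- The generator `s_i` of `A_n`, with a zero adjoined to the group: indices outside `1, …, n` give
`0`. With this convention the commutation and braid relations hold for all natural indices, and a
word has nonzero product exactly when all its letters lie in `1, …, n`. -/
noncomputable def genA (n i : ℕ) : WithZero (CoxeterMatrix.A n).Group :=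
  if h : 1 ≤ i ∧ i ≤ n then ((CoxeterMatrix.A n).simple ⟨i - 1, by omega⟩ : _) else 0

/-- The product in `A_n`, with a zero adjoined, of the generators indexed by a word. -/
noncomputable def wordProd (n : ℕ) (u : List ℕ) : WithZero (CoxeterMatrix.A n).Group :=
  (u.map (genA n)).prod

/-- A word is reduced if its letters lie in `1, …, n` and no word with the same product in `A_n` is
shorter. -/
def IsRed (n : ℕ) (u : List ℕ) : Prop :=
  wordProd n u ≠ 0 ∧ ∀ v, wordProd n v = wordProd n u → u.length ≤ v.length

lemma simple_mul_self_A {n : ℕ} (i : Fin n) :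
    (CoxeterMatrix.A n).simple i * (CoxeterMatrix.A n).simple i = 1 := by
  have := (CoxeterMatrix.A n).toCoxeterSystem.simple_mul_simple_self i
  simpa using this

lemma simple_comm_A {n : ℕ} {i j : Fin n} (h : (i : ℕ) + 1 < j) :
    (CoxeterMatrix.A n).simple i * (CoxeterMatrix.A n).simple j =
      (CoxeterMatrix.A n).simple j * (CoxeterMatrix.A n).simple i := by
  have h2 := (CoxeterMatrix.A n).toCoxeterSystem.simple_mul_simple_pow i j
  have hM : (CoxeterMatrix.A n).M i j = 2 := by
    have h1 : i ≠ j := by rintro rfl; omega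
    simp only [CoxeterMatrix.A, Matrix.of_apply, if_neg h1]
    rw [if_neg (by omega)]
  rw [hM, CoxeterMatrix.toCoxeterSystem_simple, pow_two] at h2
  rw [mul_eq_one_iff_eq_inv, mul_inv_rev, inv_eq_of_mul_eq_one_left (simple_mul_self_A i),
    inv_eq_of_mul_eq_one_left (simple_mul_self_A j)] at h2
  exact h2

lemma simple_braid_A {n : ℕ} {i j : Fin n} (h : (i : ℕ) + 1 = j) :
    (CoxeterMatrix.A n).simple i * (CoxeterMatrix.A n).simple j * (CoxeterMatrix.A n).simple i =
      (CoxeterMatrix.A n).simple j * (CoxeterMatrix.A n).simple i *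
        (CoxeterMatrix.A n).simple j := by
  have h2 := (CoxeterMatrix.A n).toCoxeterSystem.simple_mul_simple_pow i j
  have hM : (CoxeterMatrix.A n).M i j = 3 := by
    have h1 : i ≠ j := by rintro rfl; omega
    simp only [CoxeterMatrix.A, Matrix.of_apply, if_neg h1]
    rw [if_pos (by omega)]
  rw [hM, CoxeterMatrix.toCoxeterSystem_simple] at h2
  have e : ∀ a b : (CoxeterMatrix.A n).Group, (a * b) ^ 3 = (a * b * a) * (b * a * b) := by
    intro a b; simp only [pow_succ, pow_zero, one_mul, mul_assoc]
  rw [e, mul_eq_one_iff_eq_inv, mul_inv_rev, mul_inv_rev,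
    inv_eq_of_mul_eq_one_left (simple_mul_self_A i),
    inv_eq_of_mul_eq_one_left (simple_mul_self_A j), ← mul_assoc] at h2
  exact h2

lemma genA_commute (n : ℕ) {i j : ℕ} (h : i + 1 < j) : Commute (genA n i) (genA n j) := by
  unfold genA Commute SemiconjBy
  split_ifs with h1 h2
  · rw [← WithZero.coe_mul, ← WithZero.coe_mul, simple_comm_A]
    simp only; omega
  all_goals simp

lemma genA_braid (n i : ℕ) :
    genA n i * genA n (i + 1) * genA n i = genA n (i + 1) * genA n i * genA n (i + 1) := by
  unfold genA
  split_ifs with h1 h2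
  · simp only [← WithZero.coe_mul]
    rw [simple_braid_A]
    simp only; omega
  all_goals simp

lemma genA_mul_self (n i : ℕ) : genA n i * genA n i = 0 ∨ genA n i * genA n i = 1 := by
  unfold genA
  split_ifs with h1
  · right; rw [← WithZero.coe_mul, simple_mul_self_A]; rfl
  · simp

@[simp] lemma wordProd_nil (n : ℕ) : wordProd n [] = 1 := rfl

@[simp] lemma wordProd_cons (n x : ℕ) (u : List ℕ) :
    wordProd n (x :: u) = genA n x * wordProd n u := by simp [wordProd]

@[simp] lemma wordProd_append (n : ℕ) (u v : List ℕ) :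
    wordProd n (u ++ v) = wordProd n u * wordProd n v := by simp [wordProd]

lemma wordProd_commute (n x : ℕ) {A : List ℕ} (h : ∀ a ∈ A, a + 1 < x ∨ x + 1 < a) :
    genA n x * wordProd n A = wordProd n A * genA n x := by
  apply Commute.list_prod_right
  intro y hy
  obtain ⟨a, ha, rfl⟩ := List.mem_map.1 hy
  rcases h a ha with h | h
  · exact (genA_commute n h).symm
  · exact genA_commute n h

lemma IsRed.congr {n : ℕ} {u v : List ℕ} (h : IsRed n u) (hp : wordProd n v = wordProd n u)
    (hl : v.length = u.length) : IsRed n v :=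
  ⟨hp ▸ h.1, fun t ht ↦ hl ▸ h.2 t (ht.trans hp)⟩

lemma IsRed.left {n : ℕ} {u v : List ℕ} (h : IsRed n (u ++ v)) : IsRed n u := by
  refine ⟨fun h0 ↦ h.1 (by simp [h0]), fun t ht ↦ ?_⟩
  have := h.2 (t ++ v) (by simp [ht])
  simpa using this

lemma IsRed.right {n : ℕ} {u v : List ℕ} (h : IsRed n (u ++ v)) : IsRed n v := by
  refine ⟨fun h0 ↦ h.1 (by simp [h0]), fun t ht ↦ ?_⟩
  have := h.2 (u ++ t) (by simp [ht])
  simpa using this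

lemma not_isRed_square (n x : ℕ) : ¬ IsRed n [x, x] := by
  intro h
  rcases genA_mul_self n x with h1 | h1
  · exact h.1 (by simp [h1])
  · have := h.2 [] (by simp [h1])
    simp at this

/-! ### Insertion into a row -/

/-- `RowIns R x R' o`: Edelman–Greene insertion of `x` into the strictly increasing row `R` gives
the row `R'` and the letter `o` (if any) for the next row. The three cases are appending `x`,
replacing `y` by `x`, and passing on `x + 1` with the row unchanged. The combination of `x ∈ R` with
a leftmost greater entry other than `x + 1` is left out: then `R` followed by `x` is not reduced. -/
inductive RowIns : List ℕ → ℕ → List ℕ → Option ℕ → Prop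
  | append {A : List ℕ} {x : ℕ} (hA : ∀ a ∈ A, a < x) : RowIns A x (A ++ [x]) none
  | bump {A B : List ℕ} {x y : ℕ} (hA : ∀ a ∈ A, a < x) (hxy : x < y) (hB : ∀ b ∈ B, y < b) :
      RowIns (A ++ y :: B) x (A ++ x :: B) (some y)
  | braid {A B : List ℕ} {x : ℕ} (hA : ∀ a ∈ A, a < x) (hB : ∀ b ∈ B, x + 1 < b) :
      RowIns (A ++ x :: (x + 1) :: B) x (A ++ x :: (x + 1) :: B) (some (x + 1))

lemma egRow_length {R : List ℕ} {x y : ℕ} (h : (egRow R x).2 = some y) :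
    (egRow R x).1.length = R.length := by
  revert h
  unfold egRow
  cases R.find? (fun y ↦ decide (x < y)) with
  | none => simp
  | some z => simp only; split_ifs <;> simp

lemma egRow_of_none {R : List ℕ} {x : ℕ} (h : (egRow R x).2 = none) :
    (egRow R x).1 = R ++ [x] := by
  revert h
  unfold egRow
  cases R.find? (fun y ↦ decide (x < y)) with
  | none => simp
  | some z => simp only; split_ifs <;> simp

lemma eq_append_singleton_of_mem {A : List ℕ} {x : ℕ} (hs : A.Pairwise (· < ·))
    (hA : ∀ a ∈ A, a ≤ x) (hx : x ∈ A) : ∃ A', A = A' ++ [x] ∧ ∀ a ∈ A', a < x := by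
  obtain ⟨s, t, rfl⟩ := List.append_of_mem hx
  rw [List.pairwise_append, List.pairwise_cons] at hs
  have ht : t = [] := by
    apply List.eq_nil_iff_forall_not_mem.2
    intro a ha
    have h1 := hs.2.1.1 a ha
    have h2 := hA a (by simp [ha])
    omega
  subst ht
  exact ⟨s, rfl, fun a ha ↦ hs.2.2 a ha x (by simp)⟩

/-- If `R` followed by `x` is reduced, the insertion of `x` into the row `R` is one of the three
moves of `RowIns`. -/
lemma rowIns_egRow {n : ℕ} {R : List ℕ} {x : ℕ} (hs : R.Pairwise (· < ·))
    (hr : IsRed n (R ++ [x])) : RowIns R x (egRow R x).1 (egRow R x).2 := by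
  unfold egRow
  split
  · rename_i h
    rw [List.find?_eq_none] at h
    have hle : ∀ a ∈ R, a ≤ x := fun a ha ↦ by simpa using h a ha
    refine RowIns.append fun a ha ↦ lt_of_le_of_ne (hle a ha) ?_
    rintro rfl
    obtain ⟨A, rfl, -⟩ := eq_append_singleton_of_mem hs hle ha
    rw [List.append_assoc] at hr
    exact not_isRed_square n a hr.right
  · rename_i y h
    rw [List.find?_eq_some_iff_append] at h
    obtain ⟨hxy, A, B, rfl, hA⟩ := h
    have hxy : x < y := by simpa using hxy
    have hA : ∀ a ∈ A, a ≤ x := fun a ha ↦ by simpa using hA a ha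
    rw [List.pairwise_append, List.pairwise_cons] at hs
    by_cases hx : x ∈ A
    · obtain ⟨A, rfl, hA'⟩ := eq_append_singleton_of_mem hs.1 hA hx
      by_cases hy : y = x + 1
      · subst hy
        simp only [true_and]
        rw [if_pos (by simp)]
        simpa using RowIns.braid hA' hs.2.1.1
      · exfalso
        -- `x` commutes with `y` and with everything to the right of it
        have h1 : IsRed n (A ++ ([x, x] ++ (y :: B))) := by
          refine hr.congr ?_ (by simp)
          have := wordProd_commute n x (A := y :: B) (by
            intro a ha
            rcases List.mem_cons.1 ha with rfl | ha
            · omega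
            · have := hs.2.1.1 a ha; omega)
          simp only [wordProd_append, wordProd_cons, wordProd_nil, mul_one, mul_assoc] at this ⊢
          rw [this]
        exact not_isRed_square n x h1.right.left
    · have hx' : x ∉ A ++ y :: B := by
        simp only [List.mem_append, List.mem_cons, not_or]
        exact ⟨hx, by omega, fun h ↦ by have := hs.2.1.1 x h; omega⟩
      rw [if_neg (fun h ↦ hx' h.2), List.replace_append_right, List.replace_cons_self]
      · refine RowIns.bump (fun a ha ↦ lt_of_le_of_ne (hA a ha) ?_) hxy hs.2.1.1
        rintro rfl; exact hx ha
      · intro h; have := hA y h; omega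

lemma RowIns.egRow_eq {R R' : List ℕ} {x : ℕ} {o : Option ℕ} (h : RowIns R x R' o) :
    egRow R x = (R', o) := by
  cases h with
  | append hA =>
    unfold egRow
    rw [List.find?_eq_none.2 (by intro a ha; have := hA a ha; simp; omega)]
  | @bump A B _ y hA hxy hB =>
    unfold egRow
    have : (A ++ y :: B).find? (fun y ↦ decide (x < y)) = some y := by
      rw [List.find?_eq_some_iff_append]
      exact ⟨by simpa, A, B, rfl, fun a ha ↦ by have := hA a ha; simp; omega⟩
    rw [this]
    simp only
    rw [if_neg, List.replace_append_right, List.replace_cons_self]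
    · intro h; have := hA y h; omega
    · rintro ⟨rfl, h⟩
      rcases List.mem_append.1 h with h | h
      · exact lt_irrefl _ (hA x h)
      · rcases List.mem_cons.1 h with h | h
        · omega
        · have := hB x h; omega
  | @braid A B _ hA hB =>
    unfold egRow
    have : (A ++ x :: (x + 1) :: B).find? (fun y ↦ decide (x < y)) = some (x + 1) := by
      rw [List.find?_eq_some_iff_append]
      refine ⟨by simp, A ++ [x], B, by simp, fun a ha ↦ ?_⟩
      simp only [List.mem_append, List.mem_singleton] at ha
      rcases ha with ha | rfl
      · have := hA a ha; simp; omega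
      · simp
    rw [this]
    simp

lemma RowIns.pairwise {R R' : List ℕ} {x : ℕ} {o : Option ℕ} (h : RowIns R x R' o)
    (hs : R.Pairwise (· < ·)) : R'.Pairwise (· < ·) := by
  cases h with
  | append hA => simpa [List.pairwise_append, hs] using hA
  | bump hA hxy hB =>
    simp only [List.pairwise_append, List.pairwise_cons, List.mem_cons] at hs ⊢
    refine ⟨hs.1, ⟨fun a ha ↦ hxy.trans (hB a ha), hs.2.1.2⟩, fun a ha b hb ↦ ?_⟩
    rcases hb with rfl | hb
    · exact hA a ha
    · exact hs.2.2 a ha b (Or.inr hb)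
  | braid => exact hs

/-- Insertion into a row and passing on a letter are made up of Coxeter–Knuth moves. -/
lemma RowIns.wordProd_eq {n : ℕ} {R R' : List ℕ} {x y : ℕ} (h : RowIns R x R' (some y)) :
    wordProd n (R ++ [x]) = wordProd n (y :: R') := by
  cases h with
  | @bump A B _ _ hA hxy hB =>
    have h1 := wordProd_commute n x (A := B) (fun b hb ↦ by have := hB b hb; omega)
    have h2 := wordProd_commute n y (A := A) (fun b hb ↦ by have := hA b hb; omega)
    simp only [wordProd_append, wordProd_cons, wordProd_nil, mul_one, mul_assoc] at h1 h2 ⊢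
    rw [← h1, ← mul_assoc _ (wordProd n A), h2, mul_assoc]
  | @braid A B _ hA hB =>
    -- the inserted `x` moves left past `B`, then after a braid relation `x + 1` moves past `A`
    have h1 := wordProd_commute n x (A := B) (fun b hb ↦ by have := hB b hb; omega)
    have h2 := wordProd_commute n (x + 1) (A := A) (fun b hb ↦ by have := hA b hb; omega)
    have h3 := genA_braid n x
    simp only [wordProd_append, wordProd_cons, wordProd_nil, mul_one, mul_assoc] at h1 h2 h3 ⊢
    rw [← h1, ← mul_assoc _ (wordProd n A), h2, mul_assoc]
    simp only [← mul_assoc] at h3 ⊢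
    simp only [mul_assoc _ _ (genA n x)]
    simp only [← mul_assoc] at h3 ⊢
    rw [mul_assoc (wordProd n A), mul_assoc (wordProd n A), h3]
    simp only [← mul_assoc]

lemma RowIns.length_eq {R R' : List ℕ} {x y : ℕ} (h : RowIns R x R' (some y)) :
    R'.length = R.length := by
  cases h <;> simp

lemma RowIns.mem {R R' : List ℕ} {x : ℕ} {o : Option ℕ} (h : RowIns R x R' o) : x ∈ R' := by
  cases h <;> simp

lemma RowIns.bumped {R R' : List ℕ} {x y : ℕ} (h : RowIns R x R' (some y)) : y ∈ R ∧ x < y := by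
  cases h <;> simp [*]

lemma RowIns.exists_bumped {R R' : List ℕ} {x z : ℕ} {o : Option ℕ} (h : RowIns R x R' o)
    (hz : z ∈ R) (hx : x < z) : ∃ y, o = some y ∧ y ≤ z := by
  cases h with
  | append hA => have := hA z hz; omega
  | bump hA hxy hB =>
    simp only [List.mem_append, List.mem_cons] at hz
    rcases hz with hz | rfl | hz
    · have := hA z hz; omega
    · exact ⟨_, rfl, le_rfl⟩
    · exact ⟨_, rfl, (hB z hz).le⟩
  | braid hA hB => exact ⟨_, rfl, hx⟩

/-- Bumping paths of an ascent: if inserting `x < x'` in turn, the second insertion passes on a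
letter only if the first does, and then a greater one. -/
lemma RowIns.bumped_lt {R R' R'' : List ℕ} {x x' y' : ℕ} {o : Option ℕ} (h : RowIns R x R' o)
    (h' : RowIns R' x' R'' (some y')) (hx : x < x') : ∃ y, o = some y ∧ y < y' := by
  obtain ⟨hm, hlt⟩ := h'.bumped
  cases h with
  | append hA =>
    simp only [List.mem_append, List.mem_singleton] at hm
    rcases hm with hm | rfl
    · have := hA y' hm; omega
    · omega
  | bump hA hxy hB =>
    simp only [List.mem_append, List.mem_cons] at hm
    rcases hm with hm | rfl | hm
    · have := hA y' hm; omega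
    · omega
    · exact ⟨_, rfl, hB _ hm⟩
  | braid hA hB =>
    simp only [List.mem_append, List.mem_cons] at hm
    rcases hm with hm | rfl | rfl | hm
    · have := hA y' hm; omega
    · omega
    · omega
    · exact ⟨_, rfl, hB _ hm⟩

/-- Bumping paths of a descent: if inserting `x' < x` after `x`, the second insertion passes on a
letter, which is smaller than the letter passed on by the first. -/
lemma RowIns.bumped_gt {R R' R'' : List ℕ} {x x' : ℕ} {o o' : Option ℕ} (h : RowIns R x R' o)
    (h' : RowIns R' x' R'' o') (hx : x' < x) : ∃ y', o' = some y' ∧ ∀ y ∈ o, y' < y := by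
  obtain ⟨y', rfl, hle⟩ := h'.exists_bumped h.mem hx
  refine ⟨y', rfl, fun y hy ↦ ?_⟩
  obtain rfl : o = some y := hy
  exact hle.trans_lt h.bumped.2

/-- A row has at most one splitting after its last entry less than `y`. -/
lemma eq_of_append_cons_eq {A B A' B' : List ℕ} {x x' y : ℕ} (h : A ++ x :: B = A' ++ x' :: B')
    (hx : x < y) (hx' : x' < y) (hB : ∀ b ∈ B, y ≤ b) (hB' : ∀ b ∈ B', y ≤ b) :
    A = A' ∧ x = x' ∧ B = B' := by
  rcases List.append_eq_append_iff.1 h with ⟨C, rfl, hC⟩ | ⟨C, rfl, hC⟩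
  · rcases C with _ | ⟨c, C⟩
    · simpa using hC
    · simp only [List.cons_append, List.cons.injEq] at hC
      have := hB x' (by simp [hC.2])
      omega
  · rcases C with _ | ⟨c, C⟩
    · simpa [eq_comm] using hC
    · simp only [List.cons_append, List.cons.injEq] at hC
      have := hB' x (by simp [hC.2])
      omega

/-- A row insertion can be undone: the inserted letter is the greatest letter of the new row that
is less than the letter passed on. -/
lemma RowIns.injective {R₁ R₂ R' : List ℕ} {x₁ x₂ y : ℕ} (h₁ : RowIns R₁ x₁ R' (some y))
    (h₂ : RowIns R₂ x₂ R' (some y)) : R₁ = R₂ ∧ x₁ = x₂ := by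
  generalize hR : R' = R'' at h₂
  generalize hy : some y = o at h₂
  cases h₁ with
  | bump hA hxy hB =>
    cases h₂ with
    | append => simp at hy
    | bump hA' hxy' hB' =>
      obtain rfl : y = _ := by simpa using hy
      obtain ⟨rfl, rfl, rfl⟩ := eq_of_append_cons_eq hR hxy hxy' (fun b hb ↦ (hB b hb).le)
        (fun b hb ↦ (hB' b hb).le)
      exact ⟨rfl, rfl⟩
    | braid hA' hB' =>
      obtain rfl : y = _ := by simpa using hy
      obtain ⟨rfl, rfl, rfl⟩ := eq_of_append_cons_eq hR hxy (Nat.lt_succ_self _)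
        (fun b hb ↦ (hB b hb).le) (by
          intro b hb
          rcases List.mem_cons.1 hb with rfl | hb
          · exact le_rfl
          · exact (hB' b hb).le)
      have := hB (x₁ + 1) (by simp)
      omega
  | @braid A B _ hA hB =>
    have hB₁ : ∀ b ∈ (x₁ + 1) :: B, x₁ + 1 ≤ b := by
      intro b hb
      rcases List.mem_cons.1 hb with rfl | hb
      · exact le_rfl
      · exact (hB b hb).le
    cases h₂ with
    | append => simp at hy
    | bump hA' hxy' hB' =>
      obtain rfl : x₁ + 1 = _ := by simpa using hy
      obtain ⟨rfl, rfl, rfl⟩ := eq_of_append_cons_eq hR (Nat.lt_succ_self _) hxy' hB₁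
        (fun b hb ↦ (hB' b hb).le)
      have := hB' (x₁ + 1) (by simp)
      omega
    | braid hA' hB' =>
      obtain rfl : x₁ = _ := by simpa using hy
      exact ⟨hR, rfl⟩

/-- Reverse insertion into a row. -/
lemma exists_rowIns {n : ℕ} {R' : List ℕ} {y : ℕ} (hs : R'.Pairwise (· < ·))
    (hr : IsRed n (y :: R')) (hy : ∃ z ∈ R', z < y) :
    ∃ R x, RowIns R x R' (some y) ∧ R.Pairwise (· < ·) := by
  -- split `R'` after the last entry less than `y`
  have key : ∃ A x B, R' = A ++ x :: B ∧ x < y ∧ ∀ b ∈ B, y ≤ b := by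
    clear hr
    induction R' with
    | nil => simp at hy
    | cons a T ih =>
      rw [List.pairwise_cons] at hs
      by_cases h : ∃ z ∈ T, z < y
      · obtain ⟨A, x, B, rfl, h1, h2⟩ := ih hs.2 h
        exact ⟨a :: A, x, B, rfl, h1, h2⟩
      · push Not at h
        obtain ⟨z, hz, hzy⟩ := hy
        rcases List.mem_cons.1 hz with rfl | hz
        · exact ⟨[], z, T, rfl, hzy, h⟩
        · exact absurd (h z hz) (by omega)
  obtain ⟨A, x, B, rfl, hxy, hB⟩ := key
  have hs0 := hs
  simp only [List.pairwise_append, List.pairwise_cons, List.mem_cons] at hs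
  have hA : ∀ a ∈ A, a < x := fun a ha ↦ hs.2.2 a ha x (Or.inl rfl)
  by_cases hyB : y ∈ B
  · obtain ⟨B', rfl⟩ : ∃ B', B = y :: B' := by
      rcases B with _ | ⟨b, B'⟩
      · simp at hyB
      · rcases List.mem_cons.1 hyB with rfl | h
        · exact ⟨_, rfl⟩
        · have h1 := hB b (by simp)
          have h2 := (List.pairwise_cons.1 hs.2.1.2).1 y h
          omega
    have hB' : ∀ b ∈ B', y < b := (List.pairwise_cons.1 hs.2.1.2).1
    by_cases hxy' : y = x + 1
    · subst hxy'
      exact ⟨_, x, RowIns.braid hA hB', hs0⟩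
    · exfalso
      -- `y` commutes with everything to the left of its copy in the row
      have h1 : IsRed n ((A ++ [x]) ++ ([y, y] ++ B')) := by
        refine hr.congr ?_ (by simp; omega)
        have := wordProd_commute n y (A := A ++ [x]) (by
          intro a ha
          simp only [List.mem_append, List.mem_singleton] at ha
          rcases ha with ha | rfl
          · have := hA a ha; omega
          · omega)
        simp only [wordProd_append, wordProd_cons, wordProd_nil, mul_one] at this ⊢
        rw [← mul_assoc, ← mul_assoc, ← mul_assoc _ _ (genA n y * _), ← mul_assoc, this]
        simp only [mul_assoc]
      exact not_isRed_square n y h1.right.left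
  · have hB' : ∀ b ∈ B, y < b := fun b hb ↦
      lt_of_le_of_ne (hB b hb) (by rintro rfl; exact hyB hb)
    refine ⟨_, x, RowIns.bump hA hxy hB', ?_⟩
    simp only [List.pairwise_append, List.pairwise_cons, List.mem_cons]
    refine ⟨hs.1, ⟨hB', hs.2.1.2⟩, fun a ha b hb ↦ ?_⟩
    rcases hb with rfl | hb
    · exact (hA a ha).trans hxy
    · exact hs.2.2 a ha b (Or.inr hb)

/-! ### Pairs of adjacent rows -/

/-- The counting form of the condition that the columns of the two strictly increasing rows `R`
(above) and `S` (below) are strictly increasing and that `S` is not longer than `R`. -/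
def RowAbove (R S : List ℕ) : Prop :=
  ∀ z, S.countP (· ≤ z) ≤ R.countP (· < z)

lemma rowAbove_nil (R : List ℕ) : RowAbove R [] := fun z ↦ by simp

lemma countP_lt_eq_length {A : List ℕ} {x z : ℕ} (hA : ∀ a ∈ A, a < x) (h : x ≤ z) :
    A.countP (· < z) = A.length :=
  List.countP_eq_length.2 fun a ha ↦ by have := hA a ha; simp; omega

lemma countP_le_eq_length {A : List ℕ} {x z : ℕ} (hA : ∀ a ∈ A, a < x) (h : x ≤ z + 1) :
    A.countP (· ≤ z) = A.length :=
  List.countP_eq_length.2 fun a ha ↦ by have := hA a ha; simp; omega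

lemma countP_lt_eq_zero {B : List ℕ} {y z : ℕ} (hB : ∀ b ∈ B, y < b) (h : z ≤ y + 1) :
    B.countP (· < z) = 0 :=
  List.countP_eq_zero.2 fun a ha ↦ by have := hB a ha; simp; omega

lemma countP_le_eq_zero {B : List ℕ} {y z : ℕ} (hB : ∀ b ∈ B, y < b) (h : z ≤ y) :
    B.countP (· ≤ z) = 0 :=
  List.countP_eq_zero.2 fun a ha ↦ by have := hB a ha; simp; omega

lemma RowIns.countP_lt_le {R R' : List ℕ} {x y : ℕ} (h : RowIns R x R' (some y)) (z : ℕ) :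
    R.countP (· < z) ≤ R'.countP (· < z) := by
  cases h with
  | bump hA hxy hB =>
    simp only [List.countP_append, List.countP_cons, decide_eq_true_eq]
    split_ifs <;> omega
  | braid => exact le_rfl

lemma RowIns.countP_le_le {S S' : List ℕ} {y : ℕ} {o : Option ℕ} (h : RowIns S y S' o) (z : ℕ) :
    S.countP (· ≤ z) ≤ S'.countP (· ≤ z) := by
  cases h with
  | append => simp
  | bump hA hxy hB =>
    simp only [List.countP_append, List.countP_cons, decide_eq_true_eq]
    split_ifs <;> omega
  | braid => exact le_rfl

/-- If the upper row passes on `y`, then for all `z ≥ y` its number of entries `< z` after the move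
exceeds the number of entries `< t` before it, where `t` is `y`, or `y - 1` if the row is
unchanged. -/
lemma RowIns.exists_countP_lt {R R' : List ℕ} {x y : ℕ} (h : RowIns R x R' (some y)) :
    ∃ t, y ≤ t + 1 ∧ t ≤ y ∧ ∀ z, y ≤ z → R.countP (· < t) + 1 ≤ R'.countP (· < z) := by
  cases h with
  | @bump A B _ _ hA hxy hB =>
    refine ⟨y, by omega, le_rfl, fun z hz ↦ ?_⟩
    have a1 := @countP_lt_eq_length A x z hA (by omega)
    have a2 := @countP_lt_eq_length A x y hA (by omega)
    have b2 := @countP_lt_eq_zero B y y hB (by omega)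
    simp only [List.countP_append, List.countP_cons, decide_eq_true_eq]
    split_ifs <;> omega
  | @braid A B _ hA hB =>
    refine ⟨x, by omega, by omega, fun z hz ↦ ?_⟩
    have a1 := @countP_lt_eq_length A x z hA (by omega)
    have a2 := @countP_lt_eq_length A x x hA (by omega)
    have b2 := @countP_lt_eq_zero B (x + 1) x hB (by omega)
    simp only [List.countP_append, List.countP_cons, decide_eq_true_eq]
    split_ifs <;> omega

/-- Unless the row is unchanged, insertion of `y` increases the number of entries `≤ z` exactly
for `z` from `y` up to just before the letter passed on, and the old row has no entries in this
range. -/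
lemma RowIns.countP_le {S S' : List ℕ} {y : ℕ} {o : Option ℕ} (h : RowIns S y S' o) (z : ℕ) :
    S'.countP (· ≤ z) = S.countP (· ≤ z) ∨
      y ≤ z ∧ ∀ t, y ≤ t + 1 → t ≤ y → S'.countP (· ≤ z) = S.countP (· ≤ t) + 1 := by
  cases h with
  | append hC =>
    by_cases hz : y ≤ z
    · refine Or.inr ⟨hz, fun t h1 h2 ↦ ?_⟩
      have c1 := countP_le_eq_length (z := z) hC (by omega)
      have c2 := countP_le_eq_length (z := t) hC (by omega)
      simp [c1, c2, hz]
    · left; simp [hz]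
  | @bump C D _ w hC hyw hD =>
    by_cases hz : y ≤ z ∧ z < w
    · refine Or.inr ⟨hz.1, fun t h1 h2 ↦ ?_⟩
      have c1 := countP_le_eq_length (z := z) hC (by omega)
      have c2 := countP_le_eq_length (z := t) hC (by omega)
      have d1 := countP_le_eq_zero (z := z) hD (by omega)
      have d2 := countP_le_eq_zero (z := t) hD (by omega)
      simp only [List.countP_append, List.countP_cons, decide_eq_true_eq]
      split_ifs <;> omega
    · left
      simp only [List.countP_append, List.countP_cons, decide_eq_true_eq]
      split_ifs <;> omega
  | braid => exact Or.inl rfl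

/-- Unless the row is unchanged, the number of entries `< z` is greater after the move exactly for
`z` above the inserted letter and up to `y`, and the new row has no entries in this range. -/
lemma RowIns.countP_lt {R R' : List ℕ} {x y : ℕ} (h : RowIns R x R' (some y)) (z : ℕ) :
    R.countP (· < z) = R'.countP (· < z) ∨
      z ≤ y ∧ ∀ t, y ≤ t → t ≤ y + 1 → R.countP (· < z) + 1 = R'.countP (· < t) := by
  cases h with
  | @bump A B _ _ hA hxy hB =>
    by_cases hz : x < z ∧ z ≤ y
    · refine Or.inr ⟨hz.2, fun t h1 h2 ↦ ?_⟩
      have c1 := countP_lt_eq_length (z := z) hA (by omega)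
      have c2 := countP_lt_eq_length (z := t) hA (by omega)
      have d1 := countP_lt_eq_zero (z := z) hB (by omega)
      have d2 := countP_lt_eq_zero (z := t) hB (by omega)
      simp only [List.countP_append, List.countP_cons, decide_eq_true_eq]
      split_ifs <;> omega
    · left
      simp only [List.countP_append, List.countP_cons, decide_eq_true_eq]
      split_ifs <;> omega
  | braid => exact Or.inl rfl

/-- The lower row has an entry `y` after the insertion, which is counted at `t = y`, or at
`t = y + 1` together with the entry `y + 1` if the row is unchanged. -/
lemma RowIns.exists_countP_le {S S' : List ℕ} {y : ℕ} {o : Option ℕ} (h : RowIns S y S' o) :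
    ∃ t, y ≤ t ∧ t ≤ y + 1 ∧ ∀ z, z ≤ y → S.countP (· ≤ z) + 1 ≤ S'.countP (· ≤ t) := by
  cases h with
  | @append C _ hC =>
    refine ⟨y, le_rfl, by omega, fun z hz ↦ ?_⟩
    have c1 := countP_le_eq_length (z := y) hC (by omega)
    have c2 := S.countP_le_length (p := fun c ↦ decide (c ≤ z))
    simp [c1, c2]
  | @bump C D _ w hC hyw hD =>
    refine ⟨y, le_rfl, by omega, fun z hz ↦ ?_⟩
    have c1 := countP_le_eq_length (z := y) hC (by omega)
    have c2 := C.countP_le_length (p := fun c ↦ decide (c ≤ z))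
    have d1 := countP_le_eq_zero (z := z) hD (by omega)
    simp only [List.countP_append, List.countP_cons, decide_eq_true_eq]
    split_ifs <;> omega
  | @braid C D _ hC hD =>
    refine ⟨y + 1, by omega, le_rfl, fun z hz ↦ ?_⟩
    have c1 := countP_le_eq_length (z := y + 1) hC (by omega)
    have c2 := C.countP_le_length (p := fun c ↦ decide (c ≤ z))
    have d1 := countP_le_eq_zero (z := z) hD (by omega)
    simp only [List.countP_append, List.countP_cons, decide_eq_true_eq]
    split_ifs <;> omega

/-- Inserting a letter into a row and the letter passed on into the row below keeps the columns
strictly increasing. -/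
lemma RowIns.rowAbove {R R' S S' : List ℕ} {x y : ℕ} {o : Option ℕ}
    (h : RowIns R x R' (some y)) (h' : RowIns S y S' o) (hRS : RowAbove R S) :
    RowAbove R' S' := by
  intro z
  obtain ⟨t, h1, h2, h3⟩ := h.exists_countP_lt
  rcases h'.countP_le z with h4 | ⟨hz, h4⟩
  · rw [h4]; exact (hRS z).trans (h.countP_lt_le z)
  · rw [h4 t h1 h2]
    exact (Nat.add_le_add_right (hRS t) 1).trans (h3 z hz)

/-- Reverse insertion keeps the columns strictly increasing. -/
lemma RowIns.rowAbove_reverse {R R' S S' : List ℕ} {x y : ℕ} {o : Option ℕ}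
    (h : RowIns R x R' (some y)) (h' : RowIns S y S' o) (hRS : RowAbove R' S') :
    RowAbove R S := by
  intro z
  obtain ⟨t, h1, h2, h3⟩ := h'.exists_countP_le
  rcases h.countP_lt z with h4 | ⟨hz, h4⟩
  · rw [h4]; exact (h'.countP_le_le z).trans (hRS z)
  · have := (h3 z hz).trans (hRS t)
    have := h4 t h1 h2
    omega

/-! ### Insertion into a tableau -/

/-- Tableaux of partition shape with strictly increasing rows and columns, the columns being
compared row by row. -/
def IsStrictTableau : List (List ℕ) → Prop
  | [] => True
  | R :: T => R ≠ [] ∧ R.Pairwise (· < ·) ∧ RowAbove R (T.headD []) ∧ IsStrictTableau T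

@[simp] lemma readingWord_nil {α : Type*} : readingWord ([] : List (List α)) = [] := rfl

@[simp] lemma readingWord_cons {α : Type*} (R : List α) (T : List (List α)) :
    readingWord (R :: T) = readingWord T ++ R := by simp [readingWord]

lemma IsStrictTableau.headD_pairwise {T : List (List ℕ)} (h : IsStrictTableau T) :
    (T.headD []).Pairwise (· < ·) := by
  cases T with
  | nil => simp
  | cons R T => exact h.2.1

lemma isRed_headD {n : ℕ} {T : List (List ℕ)} {y : ℕ} (h : IsRed n (readingWord T ++ [y])) :
    IsRed n (T.headD [] ++ [y]) := by
  cases T with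
  | nil => exact h
  | cons R T =>
    rw [readingWord_cons, List.append_assoc] at h
    exact h.right

lemma egInsert_headD (T : List (List ℕ)) (y : ℕ) :
    (egInsert T y).1.headD [] = (egRow (T.headD []) y).1 := by
  cases T with
  | nil => rfl
  | cons R T =>
    simp only [egInsert]
    split <;> simp [*]

lemma egInsert_cons_of_none {R R' : List ℕ} {T : List (List ℕ)} {x : ℕ}
    (h : egRow R x = (R', none)) : egInsert (R :: T) x = (R' :: T, 0) := by
  simp [egInsert, h]

lemma egInsert_cons_of_some {R R' : List ℕ} {T : List (List ℕ)} {x y : ℕ}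
    (h : egRow R x = (R', some y)) :
    egInsert (R :: T) x = (R' :: (egInsert T y).1, (egInsert T y).2 + 1) := by
  simp [egInsert, h]

/-- The reading words before and after a row insertion that passes on `y` have the same product and
the same length. -/
lemma RowIns.isRed_append {n : ℕ} {u R R' v : List ℕ} {x y : ℕ} (h : RowIns R x R' (some y))
    (hr : IsRed n (u ++ R ++ [x] ++ v)) : IsRed n (u ++ [y] ++ (R' ++ v)) := by
  refine hr.congr ?_ (by simp [h.length_eq]; omega)
  have := h.wordProd_eq (n := n)
  simp only [wordProd_append, wordProd_cons, wordProd_nil, mul_one] at this ⊢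
  simp only [mul_assoc] at this ⊢
  rw [← mul_assoc (genA n y), ← this, mul_assoc]

lemma length_readingWord_egInsert (T : List (List ℕ)) (x : ℕ) :
    (readingWord (egInsert T x).1).length = (readingWord T).length + 1 := by
  induction T generalizing x with
  | nil => rfl
  | cons R T ih =>
    rcases h : egRow R x with ⟨R', _ | y⟩
    · have := egRow_of_none (R := R) (x := x) (by rw [h])
      rw [h] at this
      simp only at this
      rw [egInsert_cons_of_none h, this]
      simp; omega
    · have := egRow_length (R := R) (x := x) (y := y) (by rw [h])
      rw [h] at this
      simp only at this
      rw [egInsert_cons_of_some h]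
      simp [ih, this]; omega

/-- Inserting into a tableau preserves strictness, and the element of `A_n` of the reading word is
multiplied by the generator inserted. -/
lemma egInsert_spec {n : ℕ} {P : List (List ℕ)} {x : ℕ} (hP : IsStrictTableau P)
    (hr : IsRed n (readingWord P ++ [x])) :
    IsStrictTableau (egInsert P x).1 ∧
      wordProd n (readingWord (egInsert P x).1) = wordProd n (readingWord P ++ [x]) := by
  induction P generalizing x with
  | nil => exact ⟨⟨by simp, by simp, rowAbove_nil _, trivial⟩, rfl⟩
  | cons R T ih =>
    obtain ⟨hR, hs, hRT, hT⟩ := hP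
    rw [readingWord_cons] at hr
    have hrow := rowIns_egRow hs (List.append_assoc _ R [x] ▸ hr).right
    rcases h : egRow R x with ⟨R', _ | y⟩ <;> rw [h] at hrow <;> simp only at hrow
    · rw [egInsert_cons_of_none h]
      have h1 := egRow_of_none (R := R) (x := x) (by rw [h])
      rw [h] at h1
      simp only at h1
      refine ⟨⟨by simp [h1], hrow.pairwise hs, fun z ↦ (hRT z).trans ?_, hT⟩, ?_⟩
      · rw [h1]; simp
      · rw [readingWord_cons, readingWord_cons, h1, List.append_assoc]
    · rw [egInsert_cons_of_some h]
      have hr' : IsRed n (readingWord T ++ [y]) :=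
        (hrow.isRed_append (v := []) (by simpa using hr)).left
      obtain ⟨h1, h2⟩ := ih hT hr'
      refine ⟨⟨?_, hrow.pairwise hs, ?_, h1⟩, ?_⟩
      · exact List.ne_nil_of_mem hrow.mem
      · rw [egInsert_headD]
        exact hrow.rowAbove (rowIns_egRow hT.headD_pairwise (isRed_headD hr')) hRT
      · have h3 := hrow.wordProd_eq (n := n)
        simp only [readingWord_cons, wordProd_append, wordProd_cons, h2, wordProd_nil, mul_one,
          mul_assoc] at h3 ⊢
        rw [h3]

/-- Inserting an ascent `x < x'`: the second box is weakly above the first. -/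
lemma egInsert_row_le {n : ℕ} {P : List (List ℕ)} {x x' : ℕ} (hP : IsStrictTableau P)
    (hr : IsRed n (readingWord P ++ [x] ++ [x'])) (hx : x < x') :
    (egInsert (egInsert P x).1 x').2 ≤ (egInsert P x).2 := by
  induction P generalizing x x' with
  | nil =>
    have : egRow [x] x' = ([x, x'], none) := by simp [egRow, hx.le]
    simp [egInsert, this]
  | cons R T ih =>
    obtain ⟨hR, hs, hRT, hT⟩ := hP
    rw [readingWord_cons] at hr
    have hrow := rowIns_egRow hs (List.append_assoc _ R [x] ▸ hr.left).right
    rcases h : egRow R x with ⟨R', _ | y⟩ <;> rw [h] at hrow <;> simp only at hrow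
    · have h1 := egRow_of_none (R := R) (x := x) (by rw [h])
      rw [h] at h1
      simp only at h1
      have hrow' := rowIns_egRow (R := R') (x := x') (n := n) (hrow.pairwise hs) (by
        rw [h1]
        simp only [List.append_assoc] at hr ⊢
        exact hr.right)
      rcases h' : egRow R' x' with ⟨R'', _ | y'⟩ <;> rw [h'] at hrow' <;> simp only at hrow'
      · rw [egInsert_cons_of_none h, egInsert_cons_of_none h']
      · obtain ⟨y, hy, -⟩ := hrow.bumped_lt hrow' hx
        simp at hy
    · have hr' := hrow.isRed_append hr
      have hrow' := rowIns_egRow (hrow.pairwise hs) hr'.right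
      rw [egInsert_cons_of_some h]
      rcases h' : egRow R' x' with ⟨R'', _ | y'⟩ <;> rw [h'] at hrow' <;> simp only at hrow'
      · rw [egInsert_cons_of_none h']; simp
      · obtain ⟨_, hy, hlt⟩ := hrow.bumped_lt hrow' hx
        obtain rfl := Option.some.inj hy
        rw [egInsert_cons_of_some h']
        have := hrow'.isRed_append (u := readingWord T ++ [y]) (v := []) (by simpa using hr')
        exact Nat.succ_le_succ (ih hT this.left hlt)

/-- Inserting a descent `x > x'`: the second box is strictly below the first. -/
lemma egInsert_row_lt {n : ℕ} {P : List (List ℕ)} {x x' : ℕ} (hP : IsStrictTableau P)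
    (hr : IsRed n (readingWord P ++ [x] ++ [x'])) (hx : x' < x) :
    (egInsert P x).2 < (egInsert (egInsert P x).1 x').2 := by
  induction P generalizing x x' with
  | nil =>
    have : ∃ R y, egRow [x] x' = (R, some y) := by
      simp only [egRow, List.find?_cons, hx, decide_true]
      split_ifs <;> exact ⟨_, _, rfl⟩
    obtain ⟨R, y, h⟩ := this
    simp [egInsert, h]
  | cons R T ih =>
    obtain ⟨hR, hs, hRT, hT⟩ := hP
    rw [readingWord_cons] at hr
    have hrow := rowIns_egRow hs (List.append_assoc _ R [x] ▸ hr.left).right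
    rcases h : egRow R x with ⟨R', _ | y⟩ <;> rw [h] at hrow <;> simp only at hrow
    · have h1 := egRow_of_none (R := R) (x := x) (by rw [h])
      rw [h] at h1
      simp only at h1
      have hrow' := rowIns_egRow (R := R') (x := x') (n := n) (hrow.pairwise hs) (by
        rw [h1]
        simp only [List.append_assoc] at hr ⊢
        exact hr.right)
      obtain ⟨y', hy', -⟩ := hrow.bumped_gt hrow' hx
      rw [egInsert_cons_of_none h, egInsert_cons_of_some (R' := (egRow R' x').1) (y := y')
        (Prod.ext rfl hy')]
      simp
    · have hr' := hrow.isRed_append hr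
      have hrow' := rowIns_egRow (hrow.pairwise hs) hr'.right
      obtain ⟨y', hy', hlt⟩ := hrow.bumped_gt hrow' hx
      rw [hy'] at hrow'
      have := hrow'.isRed_append (u := readingWord T ++ [y]) (v := []) (by simpa using hr')
      rw [egInsert_cons_of_some h, egInsert_cons_of_some (R' := (egRow R' x').1) (y := y')
        (Prod.ext rfl hy')]
      exact Nat.succ_lt_succ (ih hT this.left (hlt y rfl))

/-- A tableau insertion can be undone when the row of the new box is known. -/
lemma egInsert_injective {n : ℕ} {P₁ P₂ : List (List ℕ)} {x₁ x₂ : ℕ} (h₁ : IsStrictTableau P₁)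
    (h₂ : IsStrictTableau P₂) (hr₁ : IsRed n (readingWord P₁ ++ [x₁]))
    (hr₂ : IsRed n (readingWord P₂ ++ [x₂])) (h : egInsert P₁ x₁ = egInsert P₂ x₂) :
    P₁ = P₂ ∧ x₁ = x₂ := by
  -- a tableau with a nonempty first row does not give a single box
  have aux : ∀ {R : List ℕ} {T : List (List ℕ)} {x x' : ℕ}, R ≠ [] →
      egInsert [] x ≠ egInsert (R :: T) x' := by
    intro R T x x' hR he
    rcases e : egRow R x' with ⟨R', _ | y⟩
    · rw [egInsert_cons_of_none e] at he
      have := egRow_of_none (R := R) (x := x') (by rw [e])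
      rw [e] at this
      simp only at this
      subst this
      simp only [egInsert, Prod.mk.injEq, List.cons.injEq] at he
      have := congrArg List.length he.1.1
      simp at this
      exact hR this
    · rw [egInsert_cons_of_some e] at he
      simp [egInsert] at he
  induction P₁ generalizing P₂ x₁ x₂ with
  | nil =>
    cases P₂ with
    | nil => simpa [egInsert] using h
    | cons R T => exact absurd h (aux h₂.1)
  | cons R₁ T₁ ih =>
    cases P₂ with
    | nil => exact absurd h.symm (aux h₁.1)
    | cons R₂ T₂ =>
      rw [readingWord_cons] at hr₁ hr₂
      have hrow₁ := rowIns_egRow h₁.2.1 (List.append_assoc _ R₁ _ ▸ hr₁).right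
      have hrow₂ := rowIns_egRow h₂.2.1 (List.append_assoc _ R₂ _ ▸ hr₂).right
      rcases e₁ : egRow R₁ x₁ with ⟨R₁', _ | y₁⟩ <;> rcases e₂ : egRow R₂ x₂ with ⟨R₂', _ | y₂⟩ <;>
        rw [e₁] at hrow₁ <;> rw [e₂] at hrow₂ <;> simp only at hrow₁ hrow₂
      · rw [egInsert_cons_of_none e₁, egInsert_cons_of_none e₂] at h
        have g₁ := egRow_of_none (R := R₁) (x := x₁) (by rw [e₁])
        have g₂ := egRow_of_none (R := R₂) (x := x₂) (by rw [e₂])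
        rw [e₁] at g₁
        rw [e₂] at g₂
        simp only at g₁ g₂
        simp only [g₁, g₂, Prod.mk.injEq, List.cons.injEq, and_true] at h
        obtain ⟨h3, h4⟩ := List.append_inj' h.1 rfl
        simp only [List.cons.injEq, and_true] at h4
        exact ⟨by rw [h3, h.2], h4⟩
      · rw [egInsert_cons_of_none e₁, egInsert_cons_of_some e₂] at h
        simp at h
      · rw [egInsert_cons_of_some e₁, egInsert_cons_of_none e₂] at h
        simp at h
      · rw [egInsert_cons_of_some e₁, egInsert_cons_of_some e₂] at h
        simp only [Prod.mk.injEq, List.cons.injEq, add_left_inj] at h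
        obtain ⟨⟨rfl, h4⟩, h5⟩ := h
        obtain ⟨rfl, rfl⟩ := ih h₁.2.2.2 h₂.2.2.2
          (hrow₁.isRed_append (v := []) (by simpa using hr₁)).left
          (hrow₂.isRed_append (v := []) (by simpa using hr₂)).left (Prod.ext h4 h5)
        obtain ⟨rfl, rfl⟩ := hrow₁.injective hrow₂
        exact ⟨rfl, rfl⟩

/-! ### Adding a box to a tableau -/

lemma hasPartitionShape_nil {α : Type*} : HasPartitionShape ([] : List (List α)) := by
  simp [HasPartitionShape, shape]

lemma hasPartitionShape_cons {α : Type*} {R : List α} {T : List (List α)} :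
    HasPartitionShape (R :: T) ↔
      R ≠ [] ∧ (∀ S ∈ T, S.length ≤ R.length) ∧ HasPartitionShape T := by
  simp only [HasPartitionShape, shape, List.map_cons, List.pairwise_cons, List.mem_map,
    forall_exists_index, and_imp, forall_apply_eq_imp_iff₂, List.mem_cons, forall_eq_or_imp,
    List.length_pos_iff]
  tauto

lemma HasPartitionShape.congr {α β : Type*} {T : List (List α)} {U : List (List β)}
    (h : HasPartitionShape T) (hs : shape U = shape T) : HasPartitionShape U := by
  unfold HasPartitionShape at *
  rwa [hs]

lemma shape_addBox_egInsert {α : Type*} {P : List (List ℕ)} {Q : List (List α)}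
    (h : shape Q = shape P) (x : ℕ) (a : α) :
    shape (addBox Q (egInsert P x).2 a) = shape (egInsert P x).1 := by
  induction P generalizing Q x with
  | nil =>
    obtain rfl : Q = [] := by simpa [shape] using h
    rfl
  | cons R T ih =>
    cases Q with
    | nil => simp [shape] at h
    | cons R₂ T₂ =>
      simp only [shape, List.map_cons, List.cons.injEq] at h
      rcases e : egRow R x with ⟨R', _ | y⟩
      · have := egRow_of_none (R := R) (x := x) (by rw [e])
        rw [e] at this
        simp only at this
        rw [egInsert_cons_of_none e, this]
        simp [addBox, shape, h]
      · have := egRow_length (R := R) (x := x) (y := y) (by rw [e])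
        rw [e] at this
        simp only at this
        rw [egInsert_cons_of_some e]
        have h2 := ih (Q := T₂) h.2 y
        simp only [shape] at h2
        simp [addBox, shape, h, this, h2]

lemma RowAbove.length_le {R S : List ℕ} (h : RowAbove R S) : S.length ≤ R.length := by
  have hz := h S.sum
  rw [List.countP_eq_length.2 (fun a ha ↦ by simpa using List.le_sum_of_mem ha)] at hz
  exact hz.trans List.countP_le_length

lemma IsStrictTableau.hasPartitionShape {P : List (List ℕ)} (h : IsStrictTableau P) :
    HasPartitionShape P := by
  induction P with
  | nil => exact hasPartitionShape_nil
  | cons R T ih =>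
    obtain ⟨hR, -, hRT, hT⟩ := h
    refine hasPartitionShape_cons.2 ⟨hR, fun S hS ↦ ?_, ih hT⟩
    have h1 := hRT.length_le
    cases T with
    | nil => simp at hS
    | cons R₂ T₂ =>
      rcases List.mem_cons.1 hS with rfl | hS
      · exact h1
      · exact ((hasPartitionShape_cons.1 (ih hT)).2.1 S hS).trans h1

lemma rowAbove_iff {R S : List ℕ} (hR : R.Pairwise (· < ·)) (hS : S.Pairwise (· < ·)) :
    RowAbove R S ↔ ∀ (j : ℕ) (b : ℕ), S[j]? = some b → ∃ a, R[j]? = some a ∧ a < b := by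
  induction S generalizing R with
  | nil => simp [rowAbove_nil]
  | cons b S ih =>
    rw [List.pairwise_cons] at hS
    cases R with
    | nil =>
      refine iff_of_false (fun h ↦ ?_) (fun h ↦ ?_)
      · simpa using h.length_le
      · simpa using h 0 b rfl
    | cons a R =>
      rw [List.pairwise_cons] at hR
      have key : RowAbove (a :: R) (b :: S) ↔ a < b ∧ RowAbove R S := by
        constructor
        · intro h
          have hab : a < b := by
            by_contra hab
            have hb := h b
            rw [List.countP_cons_of_pos (by simp), List.countP_cons_of_neg (by simpa using hab),
              (List.countP_eq_zero (l := R)).2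
                (fun c hc ↦ by have := hR.1 c hc; simp; omega)] at hb
            omega
          refine ⟨hab, fun z ↦ ?_⟩
          have hz := h z
          simp only [List.countP_cons, decide_eq_true_eq] at hz
          by_cases hbz : b ≤ z
          · rw [if_pos hbz, if_pos (by omega)] at hz
            omega
          · rw [List.countP_eq_zero.2 (fun c hc ↦ by have := hS.1 c hc; simp; omega)]
            omega
        · rintro ⟨hab, h⟩ z
          have hz := h z
          simp only [List.countP_cons, decide_eq_true_eq]
          split_ifs <;> omega
      rw [key, ih hR.2 hS.2]
      constructor
      · rintro ⟨h1, h2⟩ (_ | j) c hc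
        · exact ⟨a, rfl, by simpa [eq_comm] using (by simpa using hc : b = c) ▸ h1⟩
        · exact h2 j c hc
      · intro h
        refine ⟨by simpa using h 0 b rfl, fun j c hc ↦ h (j + 1) c hc⟩

/-- Reverse insertion into a tableau, starting from a removable box. The tableau `Q` gives the shape
without that box, which is at the end of row `r`. -/
lemma exists_egInsert {α : Type*} {n : ℕ} {P' : List (List ℕ)} {Q : List (List α)} {r : ℕ} {a : α}
    (hP' : IsStrictTableau P') (hr : IsRed n (readingWord P')) (hQ : HasPartitionShape Q)
    (hrQ : r ≤ Q.length) (h : shape P' = shape (addBox Q r a)) :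
    ∃ P x, IsStrictTableau P ∧ shape P = shape Q ∧ egInsert P x = (P', r) ∧
      wordProd n (readingWord P ++ [x]) = wordProd n (readingWord P') := by
  induction Q generalizing P' r with
  | nil =>
    obtain rfl : r = 0 := by simpa using hrQ
    obtain ⟨R, rfl, hR⟩ : ∃ R, P' = [R] ∧ R.length = 1 := by
      simpa [shape, addBox, List.map_eq_cons_iff] using h
    obtain ⟨x, rfl⟩ := List.length_eq_one_iff.1 hR
    exact ⟨[], x, trivial, rfl, rfl, rfl⟩
  | cons R₀ T₀ ih =>
    rw [hasPartitionShape_cons] at hQ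
    cases P' with
    | nil => cases r <;> simp [shape, addBox] at h
    | cons R' T' =>
      obtain ⟨hR', hs', hRT', hT'⟩ := hP'
      rw [readingWord_cons] at hr
      cases r with
      | zero =>
        simp only [shape, addBox, List.map_cons, List.length_append, List.length_singleton,
          List.cons.injEq] at h
        obtain ⟨R, x, rfl⟩ : ∃ R x, R' = R ++ [x] :=
          ⟨_, _, (List.dropLast_append_getLast hR').symm⟩
        have hlen : R.length = R₀.length := by simpa using h.1
        rw [List.pairwise_append] at hs'
        have hA : ∀ a ∈ R, a < x := fun a ha ↦ hs'.2.2 a ha x (by simp)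
        refine ⟨R :: T', x, ⟨?_, hs'.1, ?_, hT'⟩, by simp [shape, hlen, h.2],
          egInsert_cons_of_none (RowIns.append hA).egRow_eq, by simp⟩
        · intro h0
          rw [h0] at hlen
          exact hQ.1 (List.length_eq_zero_iff.1 hlen.symm)
        · rw [rowAbove_iff (List.pairwise_append.2 hs') hT'.headD_pairwise] at hRT'
          rw [rowAbove_iff hs'.1 hT'.headD_pairwise]
          intro j b hb
          obtain ⟨a, ha, hab⟩ := hRT' j b hb
          have hj : j < R.length := by
            have hlt : j < (T'.headD []).length := (List.getElem?_eq_some_iff.1 hb).1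
            cases T' with
            | nil => simp at hlt
            | cons S T' =>
              have h2 := h.2
              cases T₀ with
              | nil => simp at h2
              | cons S₀ T₀ =>
                simp only [List.map_cons, List.cons.injEq] at h2
                have := hQ.2.1 S₀ (by simp)
                simp only [List.headD_cons] at hlt
                omega
          rw [List.getElem?_append_left hj] at ha
          exact ⟨a, ha, hab⟩
      | succ r =>
        simp only [shape, addBox, List.map_cons, List.cons.injEq] at h
        obtain ⟨T, y, hT, hsh, hins, hprod⟩ := ih hT' hr.left hQ.2.2 (by simpa using hrQ) h.2
        have hlen : (readingWord T').length = (readingWord T ++ [y]).length := by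
          have := length_readingWord_egInsert T y
          rw [hins] at this
          simpa using this
        have hrT : IsRed n (readingWord T ++ [y]) := hr.left.congr hprod hlen.symm
        have hrow := rowIns_egRow hT.headD_pairwise (isRed_headD hrT)
        have hhead := egInsert_headD T y
        rw [hins] at hhead
        simp only at hhead
        rw [← hhead] at hrow
        have hyR' : ∃ z ∈ R', z < y := by
          rw [rowAbove_iff hs' hT'.headD_pairwise] at hRT'
          obtain ⟨j, hj⟩ := List.mem_iff_getElem?.1 hrow.mem
          obtain ⟨z, hz, hzy⟩ := hRT' j y hj
          exact ⟨z, List.mem_of_getElem? hz, hzy⟩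
        have hr2 : IsRed n (readingWord T ++ (y :: R')) := by
          refine hr.congr ?_ (by simp at hlen; simp [hlen]; omega)
          simp only [wordProd_append, wordProd_cons, ← hprod, wordProd_nil, mul_one, mul_assoc]
        obtain ⟨R, x, hRx, hsR⟩ := exists_rowIns hs' hr2.right hyR'
        refine ⟨R :: T, x, ⟨List.ne_nil_of_mem hRx.bumped.1, hsR,
          hRx.rowAbove_reverse hrow hRT', hT⟩, ?_, ?_, ?_⟩
        · simp only [shape] at hsh
          simp [shape, hsh, ← hRx.length_eq, h.1]
        · rw [egInsert_cons_of_some hRx.egRow_eq, hins]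
        · have := hRx.wordProd_eq (n := n)
          simp only [readingWord_cons, wordProd_append, wordProd_cons, wordProd_nil, mul_one,
            mul_assoc, ← hprod] at this ⊢
          rw [this]

/-! ### Columns -/

lemma column_cons {α : Type*} (R : List α) (T : List (List α)) (j : ℕ) :
    column (R :: T) j = R[j]?.toList ++ column T j := by
  unfold column
  rw [List.filterMap_cons]
  cases R[j]? <;> simp

lemma mem_column {α : Type*} {T : List (List α)} {j : ℕ} {a : α} :
    a ∈ column T j ↔ ∃ R ∈ T, R[j]? = some a := by
  simp [column]

lemma RowAbove.trans {R S U : List ℕ} (h : RowAbove R S) (h' : RowAbove S U) : RowAbove R U :=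
  fun z ↦ (h' z).trans <| (List.countP_mono_left fun a _ ha ↦ by
    simp only [decide_eq_true_eq] at ha ⊢; exact ha.le).trans (h z)

lemma IsStrictTableau.rowAbove_of_mem {R S : List ℕ} {T : List (List ℕ)}
    (h : IsStrictTableau (R :: T)) (hS : S ∈ T) : RowAbove R S := by
  induction T generalizing R with
  | nil => simp at hS
  | cons U T ih =>
    rcases List.mem_cons.1 hS with rfl | hS
    · exact h.2.2.1
    · exact h.2.2.1.trans (ih h.2.2.2 hS)

lemma IsStrictTableau.pairwise {R : List ℕ} {T : List (List ℕ)}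
    (h : IsStrictTableau T) (hR : R ∈ T) : R.Pairwise (· < ·) := by
  induction T with
  | nil => simp at hR
  | cons U T ih =>
    rcases List.mem_cons.1 hR with rfl | hR
    · exact h.2.1
    · exact ih h.2.2.2 hR

/-- Comparing adjacent rows suffices, because `RowAbove` is transitive. -/
lemma isStrictTableau_iff {P : List (List ℕ)} :
    IsStrictTableau P ↔ HasPartitionShape P ∧ (∀ R ∈ P, R.Pairwise (· < ·)) ∧
      ∀ j, (column P j).Pairwise (· < ·) := by
  constructor
  · intro h
    refine ⟨h.hasPartitionShape, fun R hR ↦ h.pairwise hR, fun j ↦ ?_⟩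
    induction P with
    | nil => simp [column]
    | cons R T ih =>
      rw [column_cons, List.pairwise_append]
      refine ⟨by cases R[j]? <;> simp, ih h.2.2.2, fun a ha b hb ↦ ?_⟩
      obtain ⟨S, hS, hb⟩ := mem_column.1 hb
      obtain ⟨c, hc, hlt⟩ := (rowAbove_iff h.2.1 (h.2.2.2.pairwise hS)).1
        (h.rowAbove_of_mem hS) j b hb
      rw [hc] at ha
      simp only [Option.toList_some, List.mem_singleton] at ha
      exact ha ▸ hlt
  · rintro ⟨h1, h2, h3⟩
    induction P with
    | nil => trivial
    | cons R T ih =>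
      obtain ⟨hR, hlen, hT⟩ := hasPartitionShape_cons.1 h1
      have hT' := ih hT (fun S hS ↦ h2 S (by simp [hS])) (fun j ↦ by
        have := h3 j
        rw [column_cons, List.pairwise_append] at this
        exact this.2.1)
      refine ⟨hR, h2 R (by simp), ?_, hT'⟩
      rw [rowAbove_iff (h2 R (by simp)) hT'.headD_pairwise]
      intro j b hb
      cases T with
      | nil => simp at hb
      | cons S T =>
        simp only [List.headD_cons] at hb
        have hj : j < R.length :=
          (List.getElem?_eq_some_iff.1 hb).1.trans_le (hlen S (by simp))
        have := h3 j
        rw [column_cons, List.pairwise_append] at this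
        exact ⟨R[j], List.getElem?_eq_getElem hj, this.2.2 _ (by simp [hj]) b
          (mem_column.2 ⟨S, by simp, hb⟩)⟩

/-! ### Boxes of the recording tableau -/

lemma getElem?_addBox {α : Type*} {Q : List (List α)} {r : ℕ} (hr : r ≤ Q.length) (a : α) (i : ℕ) :
    (addBox Q r a)[i]? = if i = r then some (Q.getD r [] ++ [a]) else Q[i]? := by
  induction Q generalizing r i with
  | nil =>
    obtain rfl : r = 0 := by simpa using hr
    cases i <;> simp [addBox]
  | cons R T ih =>
    cases r with
    | zero => cases i <;> simp [addBox]
    | succ r =>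
      cases i with
      | zero => simp [addBox]
      | succ i => simpa [addBox] using ih (by simpa using hr) i

lemma mem_addBox {α : Type*} {Q : List (List α)} {r : ℕ} (hr : r ≤ Q.length) {a : α} {R : List α}
    (h : R ∈ addBox Q r a) : R ∈ Q ∨ R = Q.getD r [] ++ [a] := by
  obtain ⟨i, hi⟩ := List.mem_iff_getElem?.1 h
  rw [getElem?_addBox hr] at hi
  split_ifs at hi
  · exact Or.inr (Option.some.inj hi).symm
  · exact Or.inl (List.mem_of_getElem? hi)

lemma exists_sublist_addBox {α : Type*} {Q : List (List α)} (r : ℕ) (a : α) {R : List α}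
    (h : R ∈ Q) : ∃ R' ∈ addBox Q r a, R.Sublist R' := by
  induction Q generalizing r with
  | nil => simp at h
  | cons S T ih =>
    rcases List.mem_cons.1 h with rfl | h
    · cases r with
      | zero => exact ⟨R ++ [a], by simp [addBox], by simp⟩
      | succ r => exact ⟨R, by simp [addBox], List.Sublist.refl _⟩
    · cases r with
      | zero => exact ⟨R, by simp [addBox, h], List.Sublist.refl _⟩
      | succ r =>
        obtain ⟨R', h1, h2⟩ := ih r h
        exact ⟨R', by simp [addBox, h1], h2⟩

lemma addBox_flatten_perm {α : Type*} (Q : List (List α)) (r : ℕ) (a : α) :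
    (addBox Q r a).flatten.Perm (Q.flatten ++ [a]) := by
  induction Q generalizing r with
  | nil => simp [addBox]
  | cons R T ih =>
    cases r with
    | zero =>
      simp only [addBox, List.flatten_cons, List.append_assoc]
      exact List.perm_append_comm.append_left R
    | succ r =>
      simp only [addBox, List.flatten_cons, List.append_assoc]
      exact (ih r).append_left R

/-- The new box lies at the bottom of its column. -/
lemma column_addBox {α : Type*} {Q : List (List α)} (hQ : HasPartitionShape Q) (r : ℕ) (a : α)
    (j : ℕ) :
    column (addBox Q r a) j =
      column Q j ++ if j = (Q.getD r []).length then [a] else [] := by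
  induction Q generalizing r with
  | nil => cases j <;> simp [addBox, column]
  | cons R T ih =>
    obtain ⟨hR, hlen, hT⟩ := hasPartitionShape_cons.1 hQ
    cases r with
    | zero =>
      simp only [addBox, column_cons, List.getD_cons_zero]
      rcases lt_trichotomy j R.length with h | h | h
      · rw [List.getElem?_append_left h, if_neg h.ne, List.append_nil]
      · subst h
        have : column T R.length = [] := by
          rw [List.eq_nil_iff_forall_not_mem]
          intro b hb
          obtain ⟨S, hS, hb⟩ := mem_column.1 hb
          have := hlen S hS
          have := (List.getElem?_eq_some_iff.1 hb).1
          omega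
        simp [this]
      · rw [if_neg h.ne', List.append_nil, List.getElem?_eq_none (by simp; omega),
          List.getElem?_eq_none h.le]
    | succ r =>
      simp only [addBox, column_cons, List.getD_cons_succ, ih hT, List.append_assoc]

/-- Removing a box at the end of a row, when no box lies below it. -/
lemma exists_addBox_eq {α : Type*} {Q : List (List α)} (hQ : HasPartitionShape Q) {r : ℕ}
    {R : List α} {a : α} (hr : Q[r]? = some (R ++ [a]))
    (hnext : ∀ S, Q[r + 1]? = some S → S.length ≤ R.length) :
    ∃ Q₀, HasPartitionShape Q₀ ∧ r ≤ Q₀.length ∧ addBox Q₀ r a = Q := by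
  induction Q generalizing r with
  | nil => simp at hr
  | cons U T ih =>
    obtain ⟨hU, hlen, hT⟩ := hasPartitionShape_cons.1 hQ
    cases r with
    | zero =>
      obtain rfl : U = R ++ [a] := by simpa using hr
      have hT0 : ∀ S ∈ T, S.length ≤ R.length := by
        intro S hS
        cases T with
        | nil => simp at hS
        | cons S₀ T =>
          have h0 := hnext S₀ (by simp)
          rcases List.mem_cons.1 hS with rfl | hS
          · exact h0
          · exact ((hasPartitionShape_cons.1 hT).2.1 S hS).trans h0
      by_cases hR : R = []
      · have : T = [] := by
          rw [List.eq_nil_iff_forall_not_mem]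
          intro S hS
          have h1 := hT0 S hS
          rw [hR] at h1
          have h2 : 0 < S.length := hT.2 _ (List.mem_map.2 ⟨S, hS, rfl⟩)
          simp at h1
          simp [h1] at h2
        exact ⟨[], hasPartitionShape_nil, by simp, by simp [addBox, this, hR]⟩
      · exact ⟨R :: T, hasPartitionShape_cons.2 ⟨hR, hT0, hT⟩, by simp, rfl⟩
    | succ r =>
      obtain ⟨Q₀, h1, h2, rfl⟩ := ih hT (by simpa using hr) (fun S hS ↦ hnext S (by simpa using hS))
      refine ⟨U :: Q₀, hasPartitionShape_cons.2 ⟨hU, fun S hS ↦ ?_, h1⟩, by simpa using h2, rfl⟩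
      obtain ⟨S', hS', hsub⟩ := exists_sublist_addBox r a hS
      exact hsub.length_le.trans (hlen S' hS')

/-- A box at the end of row `r` determines the tableau without it, if the rows are nonempty. -/
lemma addBox_injective {α : Type*} {Q₁ Q₂ : List (List α)} {r : ℕ} {a : α}
    (h₁ : HasPartitionShape Q₁) (h₂ : HasPartitionShape Q₂) (h : addBox Q₁ r a = addBox Q₂ r a) :
    Q₁ = Q₂ := by
  induction Q₁ generalizing Q₂ r with
  | nil =>
    cases Q₂ with
    | nil => rfl
    | cons R T =>
      exfalso
      have hR := (hasPartitionShape_cons.1 h₂).1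
      cases r with
      | zero =>
        simp only [addBox, List.cons.injEq] at h
        have := congrArg List.length h.1
        simp at this
        exact hR this
      | succ r =>
        simp only [addBox, List.cons.injEq] at h
        have h2 := (addBox_flatten_perm T r a).length_eq
        rw [← h.2] at h2
        simp at h2
  | cons R T ih =>
    obtain ⟨hR, -, hT⟩ := hasPartitionShape_cons.1 h₁
    cases Q₂ with
    | nil =>
      exfalso
      cases r with
      | zero =>
        simp only [addBox, List.cons.injEq] at h
        have := congrArg List.length h.1
        simp at this
        exact hR this
      | succ r =>
        simp only [addBox, List.cons.injEq] at h
        have h2 := (addBox_flatten_perm T r a).length_eq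
        rw [h.2] at h2
        simp at h2
    | cons R₂ T₂ =>
      obtain ⟨hR₂, -, hT₂⟩ := hasPartitionShape_cons.1 h₂
      cases r with
      | zero => simpa [addBox] using h
      | succ r =>
        simp only [addBox, List.cons.injEq] at h
        rw [h.1, ih hT hT₂ h.2]

/-! ### The last box of a primed tableau -/

/-- `IsLastBox Q q r`: in the order in which the boxes of a primed tableau are created, the last
one has entry `q` and lies in row `r`. The entry `q` is the greatest one, and among the boxes with
this entry the last one is the topmost if `q` is unprimed (they form a horizontal strip, created
from left to right) and the bottommost if `q` is primed (they form a vertical strip, created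
downwards). -/
def IsLastBox {k : ℕ} (Q : List (List (PrimedLetter k))) (q : PrimedLetter k) (r : ℕ) : Prop :=
  (∀ R ∈ Q, ∀ c ∈ R, c ≤ q) ∧ (∃ R, Q[r]? = some R ∧ q ∈ R) ∧
    ∀ i R, Q[i]? = some R → q ∈ R → if (ofLex q).2 then r ≤ i else i ≤ r

lemma IsLastBox.unique {k : ℕ} {Q : List (List (PrimedLetter k))} {q q' : PrimedLetter k}
    {r r' : ℕ} (h : IsLastBox Q q r) (h' : IsLastBox Q q' r') : q = q' ∧ r = r' := by
  obtain ⟨h1, ⟨R, hR, hqR⟩, h3⟩ := h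
  obtain ⟨h1', ⟨R', hR', hqR'⟩, h3'⟩ := h'
  obtain rfl : q = q' :=
    le_antisymm (h1' R (List.mem_of_getElem? hR) q hqR) (h1 R' (List.mem_of_getElem? hR') q' hqR')
  refine ⟨rfl, ?_⟩
  have a := h3 r' R' hR' hqR'
  have b := h3' r R hR hqR
  split_ifs at a b <;> omega

lemma exists_isLastBox {k : ℕ} {Q : List (List (PrimedLetter k))} (hQ : HasPartitionShape Q)
    (hne : Q ≠ []) : ∃ q r, IsLastBox Q q r := by
  have hf : Q.flatten.toFinset.Nonempty := by
    obtain ⟨R, T, rfl⟩ := List.exists_cons_of_ne_nil hne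
    obtain ⟨a, R', rfl⟩ := List.exists_cons_of_ne_nil (hasPartitionShape_cons.1 hQ).1
    exact ⟨a, by simp⟩
  obtain ⟨q, hq, hmax⟩ := Finset.exists_max_image _ id hf
  · let I : Finset ℕ := (Finset.range Q.length).filter fun i ↦ ∃ R, Q[i]? = some R ∧ q ∈ R
    have hI : ∀ i, i ∈ I ↔ ∃ R, Q[i]? = some R ∧ q ∈ R := by
      intro i
      simp only [I, Finset.mem_filter, Finset.mem_range, and_iff_right_iff_imp]
      rintro ⟨R, hR, -⟩
      exact (List.getElem?_eq_some_iff.1 hR).1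
    have hIne : I.Nonempty := by
      simp only [List.mem_toFinset, List.mem_flatten] at hq
      obtain ⟨R, hR, hqR⟩ := hq
      obtain ⟨i, hi⟩ := List.mem_iff_getElem?.1 hR
      exact ⟨i, (hI i).2 ⟨R, hi, hqR⟩⟩
    refine ⟨q, if (ofLex q).2 then I.min' hIne else I.max' hIne, ?_, ?_, ?_⟩
    · intro R hR c hc
      exact hmax c (by simpa using ⟨R, hR, hc⟩)
    · rw [← hI]
      split_ifs
      · exact I.min'_mem hIne
      · exact I.max'_mem hIne
    · intro i R hi hqR
      have := (hI i).2 ⟨R, hi, hqR⟩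
      split_ifs
      · exact I.min'_le i this
      · exact I.le_max' i this

/-- Adding a greatest entry at the end of a row, below the boxes with the same entry if it is primed
and to the right of them if it is unprimed. -/
lemma IsPrimedTableau.addBox {k : ℕ} {Q : List (List (PrimedLetter k))} {r : ℕ}
    {q : PrimedLetter k} (hQ : IsPrimedTableau k Q) (hr : r ≤ Q.length)
    (hs : HasPartitionShape (addBox Q r q)) (hmax : ∀ R ∈ Q, ∀ c ∈ R, c ≤ q)
    (hstrip : ∀ i R, Q[i]? = some R → q ∈ R → if (ofLex q).2 then r ≤ i else i < r) :
    IsPrimedTableau k (addBox Q r q) := by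
  obtain ⟨h1, h2, h3, h4, h5⟩ := hQ
  have hgetD : Q.getD r [] = [] ∨ Q[r]? = some (Q.getD r []) := by
    rcases h : Q[r]? with _ | R <;> simp [List.getD, h]
  have hrow : ∀ c ∈ Q.getD r [], c ≤ q := by
    intro c hc
    rcases hgetD with h | h
    · rw [h] at hc; simp at hc
    · exact hmax _ (List.mem_of_getElem? h) c hc
  refine ⟨hs, fun R hR ↦ ?_, fun j ↦ ?_, fun R hR i ↦ ?_, fun j i ↦ ?_⟩
  · rcases mem_addBox hr hR with hR | rfl
    · exact h2 R hR
    · rw [List.pairwise_append]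
      refine ⟨?_, by simp, fun c hc b hb ↦ ?_⟩
      · rcases hgetD with h | h
        · rw [h]; simp
        · exact h2 _ (List.mem_of_getElem? h)
      · rw [List.mem_singleton.1 hb]; exact hrow c hc
  · rw [column_addBox h1]
    split_ifs
    · rw [List.pairwise_append]
      refine ⟨h3 j, by simp, fun c hc b hb ↦ ?_⟩
      rw [List.mem_singleton.1 hb]
      obtain ⟨R, hR, hc⟩ := mem_column.1 hc
      exact hmax R hR c (List.mem_of_getElem? hc)
    · simpa using h3 j
  · rcases mem_addBox hr hR with hR | rfl
    · exact h4 R hR i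
    · rcases hgetD with h | h
      · rw [h]; exact List.count_le_length
      · rw [List.count_append, List.count_singleton]
        have := h4 _ (List.mem_of_getElem? h) i
        by_cases hq : q = primed i
        · have h0 : (Q.getD r []).count (primed i) = 0 := by
            rw [List.count_eq_zero]
            intro hm
            have := hstrip r _ h (hq ▸ hm)
            rw [hq] at this
            simp [primed] at this
          rw [h0]
          split_ifs <;> simp
        · rw [if_neg (by simpa using hq)]
          simpa using this
  · rw [column_addBox h1]
    split_ifs with hj
    · rw [List.count_append, List.count_singleton]
      by_cases hq : q = unprimed i
      · have h0 : (column Q j).count (unprimed i) = 0 := by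
          rw [List.count_eq_zero]
          intro hm
          obtain ⟨R, hR, hc⟩ := mem_column.1 hm
          obtain ⟨i', hi'⟩ := List.mem_iff_getElem?.1 hR
          have hle := hstrip i' R hi' (hq ▸ List.mem_of_getElem? hc)
          rw [hq] at hle
          simp only [unprimed, ofLex_toLex, if_true] at hle
          -- a row weakly below row `r` is too short to reach the column of the new box
          have hlen : R.length ≤ j := by
            have hi'l := (List.getElem?_eq_some_iff.1 hi').1
            have h := List.pairwise_iff_getElem.1 h1.1
            simp only [shape, List.length_map, List.getElem_map] at h
            rw [hj, List.getD_eq_getElem _ _ (hle.trans_lt hi'l),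
              ← (List.getElem?_eq_some_iff.1 hi').2]
            rcases hle.eq_or_lt with rfl | hlt
            · exact le_rfl
            · exact h r i' (hlt.trans hi'l) hi'l hlt
          have := (List.getElem?_eq_some_iff.1 hc).1
          omega
        rw [h0]
        split_ifs <;> simp
      · rw [if_neg (by simpa using hq)]
        simpa using h5 j i
    · simpa using h5 j i

lemma IsPrimedTableau.of_addBox {k : ℕ} {Q : List (List (PrimedLetter k))} {r : ℕ}
    {q : PrimedLetter k} (h : IsPrimedTableau k (PrimedEG.addBox Q r q))
    (hQ : HasPartitionShape Q) : IsPrimedTableau k Q := by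
  obtain ⟨-, h2, h3, h4, h5⟩ := h
  have hcol : ∀ j, (column Q j).Sublist (column (PrimedEG.addBox Q r q) j) := fun j ↦ by
    rw [column_addBox hQ]; simp
  refine ⟨hQ, fun R hR ↦ ?_, fun j ↦ (h3 j).sublist (hcol j), fun R hR i ↦ ?_,
    fun j i ↦ ((hcol j).count_le _).trans (h5 j i)⟩
  · obtain ⟨R', hR', hsub⟩ := exists_sublist_addBox r q hR
    exact (h2 R' hR').sublist hsub
  · obtain ⟨R', hR', hsub⟩ := exists_sublist_addBox r q hR
    exact (hsub.count_le _).trans (h4 R' hR' i)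

/-- The last box of a primed tableau can be removed. The remaining boxes with the same entry lie
strictly above it if the entry is primed, and weakly below it if the entry is unprimed. -/
lemma IsPrimedTableau.exists_addBox {k : ℕ} {Q : List (List (PrimedLetter k))}
    {q : PrimedLetter k} {r : ℕ} (hQ : IsPrimedTableau k Q) (h : IsLastBox Q q r) :
    ∃ Q₀, IsPrimedTableau k Q₀ ∧ r ≤ Q₀.length ∧ PrimedEG.addBox Q₀ r q = Q ∧
      (∀ R ∈ Q₀, ∀ c ∈ R, c ≤ q) ∧
      ∀ i R, Q₀[i]? = some R → q ∈ R → if (ofLex q).2 then r ≤ i else i < r := by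
  have hQ' := hQ
  obtain ⟨h1, h2, h3, h4, h5⟩ := hQ
  obtain ⟨l1, ⟨R, hR, hqR⟩, l3⟩ := h
  have hRQ := List.mem_of_getElem? hR
  -- the row of the last box ends in `q`
  obtain ⟨R₀, rfl⟩ : ∃ R₀, R = R₀ ++ [q] := by
    have hne := List.ne_nil_of_mem hqR
    refine ⟨R.dropLast, ?_⟩
    have hl : R.getLast hne = q := by
      refine le_antisymm (l1 R hRQ _ (List.getLast_mem hne)) ?_
      have hp := h2 R hRQ
      rw [← List.dropLast_append_getLast hne, List.pairwise_append] at hp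
      rw [← List.dropLast_append_getLast hne, List.mem_append, List.mem_singleton] at hqR
      rcases hqR with hqR | hqR
      · exact hp.2.2 q hqR _ (by simp)
      · exact hqR.le
    rw [← hl, List.dropLast_append_getLast]
  have hnext : ∀ S, Q[r + 1]? = some S → S.length ≤ R₀.length := by
    intro S hS
    by_contra! hlt
    -- the entry below the last box would be `q` as well
    have hr1 := (List.getElem?_eq_some_iff.1 hS).1
    have hsub : [R₀ ++ [q], S].Sublist Q := by
      have e1 := (List.getElem?_eq_some_iff.1 hR).2
      have e2 := (List.getElem?_eq_some_iff.1 hS).2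
      have : Q.drop r = (R₀ ++ [q]) :: S :: Q.drop (r + 2) := by
        rw [List.drop_eq_getElem_cons (by omega), List.drop_eq_getElem_cons hr1, e1, e2]
      refine List.Sublist.trans ?_ (List.drop_sublist r Q)
      rw [this]
      simp
    have hc := hsub.filterMap fun R ↦ R[R₀.length]?
    have hSj : S[R₀.length]? = some S[R₀.length] := List.getElem?_eq_getElem hlt
    have e : [R₀ ++ [q], S].filterMap (fun R ↦ R[R₀.length]?) = [q, S[R₀.length]] := by
      simp [hSj]
    rw [e] at hc
    have hle := (h3 R₀.length).sublist hc
    have hSq : S[R₀.length] = q := le_antisymm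
      (l1 S (List.mem_of_getElem? hS) _ (List.getElem_mem hlt)) (by simpa using hle)
    have hl := l3 (r + 1) S hS (hSq ▸ List.getElem_mem hlt)
    split_ifs at hl with hb
    · obtain ⟨i₀, rfl⟩ : ∃ i₀, q = unprimed i₀ := ⟨(ofLex q).1, by rw [unprimed, ← hb]; rfl⟩
      have := (hc.count_le (unprimed i₀)).trans (h5 R₀.length i₀)
      rw [hSq] at this
      simp at this
    · omega
  obtain ⟨Q₀, g1, g2, rfl⟩ := exists_addBox_eq h1 hR hnext
  refine ⟨Q₀, hQ'.of_addBox g1, g2, rfl, fun S hS c hc ↦ ?_, fun i S hS hq ↦ ?_⟩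
  · obtain ⟨S', hS', hsub⟩ := exists_sublist_addBox r q hS
    exact l1 S' hS' c (hsub.subset hc)
  · by_cases hi : i = r
    · subst hi
      split_ifs with hb
      · exact le_rfl
      · exfalso
        obtain ⟨i₀, rfl⟩ : ∃ i₀, q = primed i₀ := ⟨(ofLex q).1, by
          have : (ofLex q).2 = false := by simpa using hb
          rw [primed, ← this]; rfl⟩
        have hc := h4 _ hRQ i₀
        rw [getElem?_addBox g2, if_pos rfl, List.getD, hS] at hR
        simp only [Option.getD_some, Option.some.injEq, List.append_cancel_right_eq] at hR
        rw [List.count_append, ← hR] at hc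
        have := List.count_pos_iff.2 hq
        simp at hc
        omega
    · have hl := l3 i S (by rw [getElem?_addBox g2, if_neg hi]; exact hS) hq
      split_ifs at hl ⊢
      · exact hl
      · omega

/-- The box added last is the last box. -/
lemma isLastBox_addBox {k : ℕ} {Q : List (List (PrimedLetter k))} {r : ℕ}
    {q : PrimedLetter k} (hr : r ≤ Q.length) (hmax : ∀ R ∈ Q, ∀ c ∈ R, c ≤ q)
    (hstrip : ∀ i R, Q[i]? = some R → q ∈ R → if (ofLex q).2 then r ≤ i else i < r) :
    IsLastBox (addBox Q r q) q r := by
  refine ⟨fun R hR c hc ↦ ?_, ⟨Q.getD r [] ++ [q], by rw [getElem?_addBox hr, if_pos rfl], by simp⟩,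
    fun i R hi hq ↦ ?_⟩
  · have : c ∈ (addBox Q r q).flatten := List.mem_flatten.2 ⟨R, hR, hc⟩
    rw [(addBox_flatten_perm Q r q).mem_iff, List.mem_append, List.mem_flatten,
      List.mem_singleton] at this
    rcases this with ⟨S, hS, hc⟩ | rfl
    · exact hmax S hS c hc
    · exact le_rfl
  · rw [getElem?_addBox hr] at hi
    split_ifs at hi with h
    · subst h; simp
    · have := hstrip i R hi hq
      split_ifs at this ⊢
      · exact this
      · exact this.le

/-! ### The correspondence for words with recorded letters -/

/-- The order of the letters of a recorded word: the recording letters increase weakly, and among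
generators with the same recording letter the indices increase if it is unprimed and decrease if it
is primed. -/
def RecordedLT {k : ℕ} (p p' : ℕ × PrimedLetter k) : Prop :=
  p.2 < p'.2 ∨ p.2 = p'.2 ∧ if (ofLex p.2).2 then p.1 < p'.1 else p'.1 < p.1

/-- Reduced words of `A_n` with compatible recording letters. -/
def IsRecordedWord {k : ℕ} (n : ℕ) (L : List (ℕ × PrimedLetter k)) : Prop :=
  L.Pairwise RecordedLT ∧ IsRed n (L.map Prod.fst)

/-- Insertion of a recorded word into the empty tableau. -/
def insertWord {α : Type*} (L : List (ℕ × α)) : List (List ℕ) × List (List α) :=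
  L.foldl egStep ([], [])

lemma RecordedLT.trans {k : ℕ} {p p' p'' : ℕ × PrimedLetter k} (h : RecordedLT p p')
    (h' : RecordedLT p' p'') : RecordedLT p p'' := by
  unfold RecordedLT at *
  rcases h with h | ⟨h, h1⟩ <;> rcases h' with h' | ⟨h', h1'⟩
  · exact Or.inl (h.trans h')
  · exact Or.inl (h' ▸ h)
  · exact Or.inl (h ▸ h')
  · refine Or.inr ⟨h.trans h', ?_⟩
    rw [← h] at h1'
    split_ifs at h1 h1' ⊢ <;> omega

lemma RecordedLT.irrefl {k : ℕ} (p : ℕ × PrimedLetter k) : ¬ RecordedLT p p := by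
  unfold RecordedLT
  simp

@[simp] lemma insertWord_nil {α : Type*} : insertWord ([] : List (ℕ × α)) = ([], []) := rfl

lemma insertWord_append_singleton {α : Type*} (L : List (ℕ × α)) (p : ℕ × α) :
    insertWord (L ++ [p]) = ((egInsert (insertWord L).1 p.1).1,
      addBox (insertWord L).2 (egInsert (insertWord L).1 p.1).2 p.2) := by
  simp [insertWord, egStep]

lemma egInsert_row_le_length (P : List (List ℕ)) (x : ℕ) : (egInsert P x).2 ≤ P.length := by
  induction P generalizing x with
  | nil => simp [egInsert]
  | cons R T ih =>
    rcases e : egRow R x with ⟨R', _ | y⟩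
    · simp [egInsert_cons_of_none e]
    · simpa [egInsert_cons_of_some e] using ih y

lemma shape_insertWord {α : Type*} (L : List (ℕ × α)) :
    shape (insertWord L).2 = shape (insertWord L).1 := by
  induction L using List.reverseRecOn with
  | nil => rfl
  | append_singleton L p ih =>
    rw [insertWord_append_singleton]
    exact shape_addBox_egInsert ih _ _

lemma length_insertWord {α : Type*} (L : List (ℕ × α)) :
    (readingWord (insertWord L).1).length = L.length := by
  induction L using List.reverseRecOn with
  | nil => rfl
  | append_singleton L p ih =>
    rw [insertWord_append_singleton, length_readingWord_egInsert, ih]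
    simp

lemma insertWord_row_le_length {α : Type*} (L : List (ℕ × α)) (x : ℕ) :
    (egInsert (insertWord L).1 x).2 ≤ (insertWord L).2.length := by
  have h := congrArg List.length (shape_insertWord L)
  simp only [shape, List.length_map] at h
  rw [h]
  exact egInsert_row_le_length _ _

lemma isRed_insertWord_append {α : Type*} {n : ℕ} {L : List (ℕ × α)} {u : List ℕ}
    (h : wordProd n (readingWord (insertWord L).1) = wordProd n (L.map Prod.fst))
    (hr : IsRed n (L.map Prod.fst ++ u)) : IsRed n (readingWord (insertWord L).1 ++ u) :=
  hr.congr (by simp [h]) (by simp [length_insertWord])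

/-- The insertion tableau of a reduced word. -/
lemma insertWord_fst_spec {α : Type*} {n : ℕ} {L : List (ℕ × α)} (hr : IsRed n (L.map Prod.fst)) :
    IsStrictTableau (insertWord L).1 ∧
      wordProd n (readingWord (insertWord L).1) = wordProd n (L.map Prod.fst) := by
  induction L using List.reverseRecOn with
  | nil => exact ⟨trivial, rfl⟩
  | append_singleton L p ih =>
    rw [List.map_append] at hr
    obtain ⟨h1, h2⟩ := ih hr.left
    have := egInsert_spec h1 (isRed_insertWord_append h2 hr)
    rw [insertWord_append_singleton]
    exact ⟨this.1, this.2.trans (by simp [h2])⟩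

lemma isRed_insertWord {α : Type*} {n : ℕ} {L : List (ℕ × α)} (hr : IsRed n (L.map Prod.fst)) :
    IsRed n (readingWord (insertWord L).1) :=
  hr.congr (insertWord_fst_spec hr).2 (by simp [length_insertWord])

/-- The recording tableau of a recorded word is a primed tableau, whose last box is the box added
last. -/
lemma insertWord_snd_spec {k n : ℕ} {L : List (ℕ × PrimedLetter k)} (hL : IsRecordedWord n L) :
    IsPrimedTableau k (insertWord L).2 ∧ ∀ L₀ p, L = L₀ ++ [p] →
      IsLastBox (insertWord L).2 p.2 (egInsert (insertWord L₀).1 p.1).2 := by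
  induction L using List.reverseRecOn with
  | nil => simp [IsPrimedTableau, hasPartitionShape_nil, column]
  | append_singleton L p ih =>
    obtain ⟨hp, hr⟩ := hL
    have hr' := hr
    rw [List.map_append] at hr'
    obtain ⟨h1, h2⟩ := ih ⟨(List.pairwise_append.1 hp).1, hr'.left⟩
    have key : (∀ R ∈ (insertWord L).2, ∀ c ∈ R, c ≤ p.2) ∧
        ∀ i R, (insertWord L).2[i]? = some R → p.2 ∈ R →
          if (ofLex p.2).2 then (egInsert (insertWord L).1 p.1).2 ≤ i
          else i < (egInsert (insertWord L).1 p.1).2 := by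
      rcases L.eq_nil_or_concat with rfl | ⟨L₀, p₀, hL₀⟩
      · simp
      · rw [List.concat_eq_append] at hL₀
        subst hL₀
        obtain ⟨l1, -, l3⟩ := h2 L₀ p₀ rfl
        have hlt : RecordedLT p₀ p := (List.pairwise_append.1 hp).2.2 p₀ (by simp) p (by simp)
        rcases hlt with hlt | ⟨heq, hlt⟩
        · refine ⟨fun R hR c hc ↦ (l1 R hR c hc).trans hlt.le, fun i R hi hq ↦ ?_⟩
          exact absurd (l1 R (List.mem_of_getElem? hi) _ hq) (not_le.2 hlt)
        · rw [heq] at l1 l3 hlt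
          refine ⟨l1, fun i R hi hq ↦ ?_⟩
          have hl := l3 i R hi hq
          rw [List.map_append, List.append_assoc] at hr'
          obtain ⟨g1, g2⟩ := insertWord_fst_spec hr'.left
          have hr₀ := isRed_insertWord_append g2 hr'
          simp only [List.map_cons, List.map_nil, ← List.append_assoc] at hr₀
          rw [insertWord_append_singleton]
          split_ifs at hl hlt ⊢
          · exact (egInsert_row_le g1 hr₀ hlt).trans hl
          · exact hl.trans_lt (egInsert_row_lt g1 hr₀ hlt)
    have hshape := shape_insertWord (L ++ [p])
    have hpart := (insertWord_fst_spec hr).1.hasPartitionShape.congr hshape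
    rw [insertWord_append_singleton] at hpart ⊢
    refine ⟨h1.addBox (insertWord_row_le_length _ _) hpart key.1 key.2, fun L₀ p₀ he ↦ ?_⟩
    obtain ⟨rfl, he⟩ := List.append_inj' he rfl
    obtain rfl : p = p₀ := by simpa using he
    exact isLastBox_addBox (insertWord_row_le_length _ _) key.1 key.2

/-- The last box of the recording tableau determines the last recorded letter and the row from which
to insert in reverse. -/
lemma insertWord_injective {k n : ℕ} {L L' : List (ℕ × PrimedLetter k)} (hL : IsRecordedWord n L)
    (hL' : IsRecordedWord n L') (h : insertWord L = insertWord L') : L = L' := by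
  have hlen : L.length = L'.length := by
    rw [← length_insertWord L, h, length_insertWord]
  induction L using List.reverseRecOn generalizing L' with
  | nil => exact (List.length_eq_zero_iff.1 hlen.symm).symm
  | append_singleton L p ih =>
    rcases L'.eq_nil_or_concat with rfl | ⟨L', p', hL₀⟩
    · simp at hlen
    · rw [List.concat_eq_append] at hL₀
      subst hL₀
      have hb := (insertWord_snd_spec hL).2 L p rfl
      have hb' := (insertWord_snd_spec hL').2 L' p' rfl
      rw [← h] at hb'
      obtain ⟨hq, hrow⟩ := hb.unique hb'
      obtain ⟨hp, hr⟩ := hL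
      obtain ⟨hp', hr'⟩ := hL'
      rw [List.map_append] at hr hr'
      have hW : IsRecordedWord n L := ⟨(List.pairwise_append.1 hp).1, hr.left⟩
      have hW' : IsRecordedWord n L' := ⟨(List.pairwise_append.1 hp').1, hr'.left⟩
      rw [insertWord_append_singleton, insertWord_append_singleton, Prod.mk.injEq, ← hrow,
        ← hq] at h
      obtain ⟨g1, g2⟩ := insertWord_fst_spec hr.left
      obtain ⟨g1', g2'⟩ := insertWord_fst_spec hr'.left
      obtain ⟨hP, hx⟩ := egInsert_injective g1 g1' (isRed_insertWord_append g2 hr)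
        (isRed_insertWord_append g2' hr') (Prod.ext h.1 hrow)
      have hQ := addBox_injective (insertWord_snd_spec hW).1.1 (insertWord_snd_spec hW').1.1 h.2
      rw [ih hW hW' (Prod.ext hP hQ) (by simpa using hlen), Prod.ext hx hq]

/-- Removing the last box of the recording tableau and inserting in reverse, again and again, gives
a recorded word. The letters removed successively are compatible with their recording letters, since
otherwise the two boxes would be created in the opposite relative position. -/
lemma exists_insertWord_eq {k n : ℕ} {P : List (List ℕ)} {Q : List (List (PrimedLetter k))}
    (hP : IsStrictTableau P) (hr : IsRed n (readingWord P)) (hQ : IsPrimedTableau k Q)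
    (hs : shape Q = shape P) : ∃ L, IsRecordedWord n L ∧ insertWord L = (P, Q) := by
  induction hm : (readingWord P).length generalizing P Q with
  | zero =>
    have hP0 : P = [] := by
      cases P with
      | nil => rfl
      | cons R T =>
        rw [readingWord_cons, List.length_append] at hm
        exact absurd (List.length_eq_zero_iff.1 (by omega)) hP.1
    subst hP0
    obtain rfl : Q = [] := by simpa [shape] using hs
    exact ⟨[], ⟨List.Pairwise.nil, hr⟩, rfl⟩
  | succ m ih =>
    have hne : Q ≠ [] := by
      rintro rfl
      obtain rfl : P = [] := by simpa [shape, eq_comm] using hs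
      simp at hm
    obtain ⟨q, r, hb⟩ := exists_isLastBox hQ.1 hne
    obtain ⟨Q₀, hQ₀, hrQ, rfl, hmax, hstrip⟩ := hQ.exists_addBox hb
    obtain ⟨P₀, x, hP₀, hs₀, hins, hprod⟩ := exists_egInsert hP hr hQ₀.1 hrQ hs.symm
    have hlen : (readingWord P).length = (readingWord P₀).length + 1 := by
      rw [← length_readingWord_egInsert P₀ x, hins]
    have hr₀ : IsRed n (readingWord P₀ ++ [x]) := hr.congr hprod (by simp [hlen])
    obtain ⟨L, hL, hLe⟩ := ih hP₀ hr₀.left hQ₀ hs₀.symm (by omega)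
    refine ⟨L ++ [(x, q)], ⟨?_, ?_⟩, ?_⟩
    · -- it suffices to compare the new letter with the last letter of `L`
      have hlast : ∀ L₁ p, L = L₁ ++ [p] → RecordedLT p (x, q) := by
        rintro L₁ p rfl
        have hb₁ := (insertWord_snd_spec hL).2 L₁ p rfl
        rw [hLe] at hb₁
        obtain ⟨-, ⟨R, hR, hpR⟩, -⟩ := hb₁
        rcases (hmax R (List.mem_of_getElem? hR) _ hpR).lt_or_eq with hlt | heq
        · exact Or.inl hlt
        · refine Or.inr ⟨heq, ?_⟩
          have hst := hstrip _ R hR (heq ▸ hpR)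
          have hred := hL.2
          rw [List.map_append] at hred
          obtain ⟨g1, g2⟩ := insertWord_fst_spec hred.left
          have hP₀e : (egInsert (insertWord L₁).1 p.1).1 = P₀ := by
            have := congrArg Prod.fst hLe
            rwa [insertWord_append_singleton] at this
          have hspec := egInsert_spec g1 (isRed_insertWord_append g2 hred)
          have hr₁ : IsRed n (readingWord (insertWord L₁).1 ++ [p.1] ++ [x]) := by
            refine hr₀.congr ?_ ?_
            · rw [← hP₀e, wordProd_append, ← hspec.2, ← wordProd_append]
            · rw [← hP₀e]
              simp [length_readingWord_egInsert]
          have hne : p.1 ≠ x := by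
            intro h
            rw [h, List.append_assoc] at hr₁
            exact not_isRed_square n x hr₁.right
          have hrow : (egInsert (egInsert (insertWord L₁).1 p.1).1 x).2 = r := by
            rw [hP₀e, hins]
          rw [heq]
          simp only at hst ⊢
          split_ifs at hst ⊢
          · by_contra hx
            have := egInsert_row_lt g1 hr₁ (by omega)
            omega
          · by_contra hx
            have := egInsert_row_le g1 hr₁ (by omega)
            omega
      rw [List.pairwise_append]
      refine ⟨hL.1, by simp, fun p hp b hb ↦ ?_⟩
      rw [List.mem_singleton.1 hb]
      rcases L.eq_nil_or_concat with rfl | ⟨L₁, p₁, hL₁⟩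
      · simp at hp
      · rw [List.concat_eq_append] at hL₁
        subst hL₁
        have h1 := hlast L₁ p₁ rfl
        rcases List.mem_append.1 hp with hp | hp
        · exact ((List.pairwise_append.1 hL.1).2.2 p hp p₁ (by simp)).trans h1
        · rwa [List.mem_singleton.1 hp]
    · have h2 := (insertWord_fst_spec hL.2).2
      have h3 := length_insertWord L
      rw [hLe] at h2 h3
      refine hr₀.congr ?_ (by simp [h3])
      simp [h2]
    · rw [insertWord_append_singleton, hLe]
      simp [hins]

lemma insertWord_snd_flatten_perm {α : Type*} (L : List (ℕ × α)) :
    (insertWord L).2.flatten.Perm (L.map Prod.snd) := by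
  induction L using List.reverseRecOn with
  | nil => simp
  | append_singleton L p ih =>
    rw [insertWord_append_singleton, List.map_append]
    exact (addBox_flatten_perm _ _ _).trans (ih.append_right _)

/-! ### Reduced words in `A_n` and in `C_{n+1}` -/

/-- The retraction of `C_{n+1}` onto `A_n` that sends `s_0` to `1`. -/
noncomputable def retractionCA (n : ℕ) : (coxeterC n).Group →* (CoxeterMatrix.A n).Group :=
  (coxeterC n).toCoxeterSystem.lift
    ⟨Fin.cases 1 fun i ↦ (CoxeterMatrix.A n).simple i, by
      intro i j
      have hs := fun i ↦ simple_mul_self_A (n := n) i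
      refine Fin.cases ?_ (fun i ↦ ?_) i <;> refine Fin.cases ?_ (fun j ↦ ?_) j
      · simp
      -- the order of `s_0 s_j` is even for `j ≠ 0`
      · have : Even ((coxeterC n).M 0 j.succ) := by
          simp only [coxeterC, Matrix.of_apply]
          rw [if_neg (Fin.succ_ne_zero j).symm]
          split_ifs <;> simp_all
          all_goals decide
        obtain ⟨m, hm⟩ := this
        simp [hm, ← two_mul, pow_mul, pow_two, hs]
      · have : Even ((coxeterC n).M i.succ 0) := by
          simp only [coxeterC, Matrix.of_apply]
          rw [if_neg (Fin.succ_ne_zero i)]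
          split_ifs <;> simp_all
          all_goals decide
        obtain ⟨m, hm⟩ := this
        simp [hm, ← two_mul, pow_mul, pow_two, hs]
      · have h : (coxeterC n).M i.succ j.succ = (CoxeterMatrix.A n).M i j := by
          simp only [coxeterC, CoxeterMatrix.A, Matrix.of_apply, Fin.succ_inj, Fin.succ_ne_zero,
            or_self, if_false, Fin.val_succ, add_left_inj, or_comm (a := (j : ℕ) + 1 = i)]
        simp only [Fin.cases_succ]
        rw [h]
        exact (CoxeterMatrix.A n).toCoxeterSystem.simple_mul_simple_pow i j⟩

lemma retractionCA_simple (n : ℕ) (i : Fin (n + 1)) :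
    retractionCA n ((coxeterC n).simple i) =
      Fin.cases 1 (fun i ↦ (CoxeterMatrix.A n).simple i) i :=
  (coxeterC n).toCoxeterSystem.lift_apply_simple _ i

lemma inclAC_simple (n : ℕ) (i : Fin n) :
    inclAC n ((CoxeterMatrix.A n).simple i) = (coxeterC n).simple i.succ :=
  (CoxeterMatrix.A n).toCoxeterSystem.lift_apply_simple _ i

lemma retractionCA_inclAC (n : ℕ) (w : (CoxeterMatrix.A n).Group) :
    retractionCA n (inclAC n w) = w := by
  have : (retractionCA n).comp (inclAC n) = MonoidHom.id _ := by
    apply (CoxeterMatrix.A n).toCoxeterSystem.ext_simple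
    intro i
    simp [inclAC_simple, retractionCA_simple]
  exact DFunLike.congr_fun this w

lemma genA_succ {n : ℕ} (i : Fin n) : genA n (i + 1) = ((CoxeterMatrix.A n).simple i : _) := by
  have := i.2
  simp only [genA]
  rw [dif_pos (by omega)]
  rfl

lemma exists_of_genA_ne_zero {n a : ℕ} (h : genA n a ≠ 0) : ∃ i : Fin n, (i : ℕ) + 1 = a := by
  unfold genA at h
  split_ifs at h with h1
  · exact ⟨⟨a - 1, by omega⟩, by simp only; omega⟩
  · exact absurd rfl h

lemma exists_of_wordProd_ne_zero {n : ℕ} {v : List ℕ} (h : wordProd n v ≠ 0) :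
    ∃ u : List (Fin n), u.map (fun i : Fin n ↦ (i : ℕ) + 1) = v := by
  induction v with
  | nil => exact ⟨[], rfl⟩
  | cons a v ih =>
    rw [wordProd_cons] at h
    obtain ⟨i, hi⟩ := exists_of_genA_ne_zero (left_ne_zero_of_mul h)
    obtain ⟨u, hu⟩ := ih (right_ne_zero_of_mul h)
    exact ⟨i :: u, by simp [hi, hu]⟩

lemma wordProd_map_succ {n : ℕ} (u : List (Fin n)) :
    wordProd n (u.map fun i : Fin n ↦ (i : ℕ) + 1) =
      ((u.map (CoxeterMatrix.A n).simple).prod : (CoxeterMatrix.A n).Group) := by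
  induction u with
  | nil => rfl
  | cons i u ih =>
    rw [List.map_cons, wordProd_cons, ih, genA_succ, List.map_cons, List.prod_cons,
      WithZero.coe_mul]

lemma exists_isReducedWord_iff {n : ℕ} {w : (CoxeterMatrix.A n).Group} {v : List ℕ} :
    (∃ u : List (Fin n), u.map (fun i : Fin n ↦ (i : ℕ) + 1) = v ∧
      IsReducedWord (CoxeterMatrix.A n).simple w u) ↔ IsRed n v ∧ wordProd n v = w := by
  constructor
  · rintro ⟨u, rfl, rfl, hu⟩
    refine ⟨⟨by rw [wordProd_map_succ]; exact WithZero.coe_ne_zero, fun t ht ↦ ?_⟩,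
      wordProd_map_succ u⟩
    obtain ⟨u', rfl⟩ := exists_of_wordProd_ne_zero (n := n) (v := t) (by
      rw [ht, wordProd_map_succ]; exact WithZero.coe_ne_zero)
    rw [wordProd_map_succ, wordProd_map_succ, WithZero.coe_inj] at ht
    simpa using hu u' ht
  · rintro ⟨hv, hw⟩
    obtain ⟨u, rfl⟩ := exists_of_wordProd_ne_zero hv.1
    have hu := hw
    rw [wordProd_map_succ, WithZero.coe_inj] at hu
    refine ⟨u, rfl, hu, fun u' hu' ↦ ?_⟩
    have := hv.2 (u'.map fun i : Fin n ↦ (i : ℕ) + 1) (by rw [wordProd_map_succ, hu', hw])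
    simpa using this

/-- The unsigned indices of a word in the signed generators. -/
def absWord {n : ℕ} (f : List (SignedIndex n)) : List ℕ := f.map fun i ↦ i.1.natAbs

lemma prod_signedGen_of_wordProd {n : ℕ} {f : List (SignedIndex n)}
    {w : (CoxeterMatrix.A n).Group} (h : wordProd n (absWord f) = w) :
    (f.map (signedGen n)).prod = inclAC n w := by
  induction f generalizing w with
  | nil =>
    obtain rfl : 1 = w := by
      rw [← WithZero.coe_inj, ← h]; rfl
    simp
  | cons i f ih =>
    have h0 : wordProd n (absWord (i :: f)) ≠ 0 := by rw [h]; exact WithZero.coe_ne_zero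
    rw [absWord, List.map_cons, wordProd_cons] at h h0
    obtain ⟨j, hj⟩ := exists_of_genA_ne_zero (left_ne_zero_of_mul h0)
    obtain ⟨w', hw'⟩ := WithZero.ne_zero_iff_exists.1 (right_ne_zero_of_mul h0)
    rw [← hw', ← hj, genA_succ, ← WithZero.coe_mul, WithZero.coe_inj] at h
    rw [← h, map_mul, inclAC_simple, ← ih hw'.symm, List.map_cons, List.prod_cons, signedGen]
    congr 2
    ext
    simp [hj]

lemma wordProd_filter_ne_zero {n : ℕ} (f : List (SignedIndex n)) :
    wordProd n (absWord (f.filter fun i ↦ i.1 ≠ 0)) =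
      retractionCA n (f.map (signedGen n)).prod := by
  induction f with
  | nil => simp [absWord]
  | cons i f ih =>
    rw [List.map_cons, List.prod_cons, map_mul, WithZero.coe_mul, ← ih, signedGen,
      retractionCA_simple]
    by_cases hi : i.1 = 0
    · rw [List.filter_cons_of_neg (by simpa using hi)]
      have : (⟨i.1.natAbs, by have := i.2.1; have := i.2.2; omega⟩ : Fin (n + 1)) = 0 := by
        ext; simp [hi]
      rw [this]
      simp
    · rw [List.filter_cons_of_pos (by simpa using hi)]
      have h2 : i.1.natAbs - 1 < n := by have := i.2.1; have := i.2.2; omega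
      have : (⟨i.1.natAbs, by have := i.2.1; have := i.2.2; omega⟩ : Fin (n + 1)) =
          Fin.succ ⟨i.1.natAbs - 1, h2⟩ := by
        ext; simp only [Fin.val_succ]; omega
      rw [this, Fin.cases_succ, ← genA_succ]
      simp only [absWord, List.map_cons, wordProd_cons]
      rw [Nat.sub_add_cancel (by omega)]

/-- The reduced words in the signed generators for an element of `A_n` do not contain `s_0`, and
without the signs they are its reduced words in `A_n`: the retraction of `C_{n+1}` onto `A_n`
deletes the letters `s_0`. -/
lemma isReducedWord_signedGen_iff {n : ℕ} {w : (CoxeterMatrix.A n).Group}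
    {f : List (SignedIndex n)} :
    IsReducedWord (signedGen n) (inclAC n w) f ↔
      IsRed n (absWord f) ∧ wordProd n (absWord f) = w := by
  constructor
  · rintro ⟨hf, hmin⟩
    have h1 := wordProd_filter_ne_zero f
    rw [hf, retractionCA_inclAC] at h1
    have h2 : f.filter (fun i ↦ i.1 ≠ 0) = f :=
      List.filter_sublist.eq_of_length_le (hmin _ (prod_signedGen_of_wordProd h1))
    rw [h2] at h1
    refine ⟨⟨by rw [h1]; exact WithZero.coe_ne_zero, fun t ht ↦ ?_⟩, h1⟩
    obtain ⟨u, rfl⟩ := exists_of_wordProd_ne_zero (n := n) (v := t) (by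
      rw [ht, h1]; exact WithZero.coe_ne_zero)
    let g : List (SignedIndex n) := u.map fun i : Fin n ↦ ⟨((i : ℕ) : ℤ) + 1, by
      have := i.2
      constructor <;> omega⟩
    have hg : absWord g = u.map fun i : Fin n ↦ (i : ℕ) + 1 := by
      simp only [absWord, g, List.map_map]
      refine List.map_congr_left fun i _ ↦ ?_
      simp only [Function.comp_apply]
      omega
    have := hmin g (prod_signedGen_of_wordProd (by rw [hg, ht, h1]))
    simpa [absWord, g] using this
  · rintro ⟨hr, hw⟩
    refine ⟨prod_signedGen_of_wordProd hw, fun u hu ↦ ?_⟩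
    have h1 := wordProd_filter_ne_zero u
    rw [hu, retractionCA_inclAC, ← hw] at h1
    have := hr.2 _ h1
    simp only [absWord, List.length_map] at this
    exact this.trans (List.length_filter_le _ _)

/-! ### Factorizations as recorded words -/

/-- The recorded letter of the generator `s_i` in the `l`-th part. -/
def recordedLetter {n k : ℕ} (l : Fin k) (i : SignedIndex n) : ℕ × PrimedLetter k :=
  (i.1.natAbs, if i.1 < 0 then primed l else unprimed l)

lemma recordedWord_eq {n k : ℕ} (v : Fin k → List (SignedIndex n)) :
    recordedWord v = (List.ofFn fun l ↦ (v l).map (recordedLetter l)).flatten := rfl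

lemma map_fst_recordedWord {n k : ℕ} (v : Fin k → List (SignedIndex n)) :
    (recordedWord v).map Prod.fst = absWord (List.ofFn v).flatten := by
  rw [recordedWord_eq, absWord, List.map_flatten, List.map_flatten, List.map_ofFn, List.map_ofFn]
  congr 2
  funext l
  simp only [Function.comp_apply, List.map_map]
  rfl

lemma primed_lt_unprimed {k : ℕ} (l : Fin k) : primed l < unprimed l :=
  Prod.Lex.toLex_lt_toLex.2 (Or.inr ⟨rfl, Bool.false_lt_true⟩)

lemma recordedLT_recordedLetter_of_lt {n k : ℕ} {l l' : Fin k} (h : l < l')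
    (i i' : SignedIndex n) : RecordedLT (recordedLetter l i) (recordedLetter l' i') := by
  left
  unfold recordedLetter
  simp only
  split_ifs <;> exact Prod.Lex.toLex_lt_toLex.2 (Or.inl h)

lemma recordedLT_recordedLetter {n k : ℕ} (l : Fin k) {i i' : SignedIndex n} (h : i < i') :
    RecordedLT (recordedLetter l i) (recordedLetter l i') := by
  have h : i.1 < i'.1 := h
  unfold recordedLetter RecordedLT
  by_cases h1 : i.1 < 0 <;> by_cases h2 : i'.1 < 0
  · right; simp [h1, h2, primed]; omega
  · left; simp [h1, h2, primed_lt_unprimed]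
  · omega
  · right; simp [h1, h2, unprimed]; omega

lemma recordedLetter_injective {n k : ℕ} {l l' : Fin k} {i i' : SignedIndex n}
    (h : recordedLetter l i = recordedLetter l' i') : l = l' ∧ i = i' := by
  unfold recordedLetter at h
  rw [Prod.mk.injEq] at h
  obtain ⟨h1, h2⟩ := h
  have : l = l' ∧ (i.1 < 0 ↔ i'.1 < 0) := by
    split_ifs at h2 with a b b <;> 
      simp only [primed, unprimed, toLex_inj, Prod.mk.injEq, reduceCtorEq, and_false, and_true]
        at h2 <;> exact ⟨h2, by tauto⟩
  refine ⟨this.1, Subtype.ext ?_⟩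
  have := this.2
  omega

lemma recordedWord_pairwise {n k : ℕ} {v : Fin k → List (SignedIndex n)}
    (hv : ∀ l, (v l).Pairwise (· < ·)) : (recordedWord v).Pairwise RecordedLT := by
  rw [recordedWord_eq, List.pairwise_flatten]
  refine ⟨fun p hp ↦ ?_, ?_⟩
  · obtain ⟨l, rfl⟩ := List.mem_ofFn.1 hp
    rw [List.pairwise_map]
    exact (hv l).imp fun h ↦ recordedLT_recordedLetter l h
  · rw [List.pairwise_ofFn]
    intro l l' hl p hp p' hp'
    obtain ⟨i, -, rfl⟩ := List.mem_map.1 hp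
    obtain ⟨i', -, rfl⟩ := List.mem_map.1 hp'
    exact recordedLT_recordedLetter_of_lt hl i i'

lemma mem_recordedWord {n k : ℕ} {v : Fin k → List (SignedIndex n)} {p : ℕ × PrimedLetter k} :
    p ∈ recordedWord v ↔ ∃ l, ∃ i ∈ v l, recordedLetter l i = p := by
  rw [recordedWord_eq, List.mem_flatten]
  constructor
  · rintro ⟨u, hu, hp⟩
    obtain ⟨l, rfl⟩ := List.mem_ofFn.1 hu
    obtain ⟨i, hi, rfl⟩ := List.mem_map.1 hp
    exact ⟨l, i, hi, rfl⟩
  · rintro ⟨l, i, hi, rfl⟩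
    exact ⟨_, List.mem_ofFn.2 ⟨l, rfl⟩, List.mem_map.2 ⟨i, hi, rfl⟩⟩

lemma recordedWord_injective {n k : ℕ} {v v' : Fin k → List (SignedIndex n)}
    (hv : ∀ l, (v l).Pairwise (· < ·)) (hv' : ∀ l, (v' l).Pairwise (· < ·))
    (h : recordedWord v = recordedWord v') : v = v' := by
  have key : ∀ {v : Fin k → List (SignedIndex n)} (l : Fin k) (i : SignedIndex n),
      i ∈ v l ↔ recordedLetter l i ∈ recordedWord v := by
    intro v l i
    rw [mem_recordedWord]
    constructor
    · exact fun hi ↦ ⟨l, i, hi, rfl⟩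
    · rintro ⟨l', i', hi', he⟩
      obtain ⟨rfl, rfl⟩ := recordedLetter_injective he
      exact hi'
  funext l
  exact (hv l).eq_of_mem_iff (hv' l) fun i ↦ by rw [key, key, h]

instance {k : ℕ} : Std.Irrefl (RecordedLT (k := k)) := ⟨RecordedLT.irrefl⟩

instance {k : ℕ} : Std.Antisymm (RecordedLT (k := k)) :=
  ⟨fun p _ h h' ↦ absurd (h.trans h') (RecordedLT.irrefl p)⟩

/-- A recorded word comes from the factorization whose `l`-th part consists of the indices `i` such
that the recorded letter of `s_i` in the `l`-th part occurs. Both words are strictly ordered by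
`RecordedLT` and have the same letters. -/
lemma exists_recordedWord_eq {n k : ℕ} {L : List (ℕ × PrimedLetter k)} (hL : IsRecordedWord n L) :
    ∃ v : Fin k → List (SignedIndex n), (∀ l, (v l).Pairwise (· < ·)) ∧ recordedWord v = L := by
  classical
  let v : Fin k → List (SignedIndex n) := fun l ↦
    (Finset.univ.filter fun i ↦ recordedLetter l i ∈ L).sort (· ≤ ·)
  have hv : ∀ l, (v l).Pairwise (· < ·) := fun l ↦ Finset.sortedLT_sort _ |>.pairwise
  have hmem : ∀ l i, i ∈ v l ↔ recordedLetter l i ∈ L := fun l i ↦ by simp [v]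
  refine ⟨v, hv, (recordedWord_pairwise hv).eq_of_mem_iff hL.1 fun p ↦ ?_⟩
  rw [mem_recordedWord]
  constructor
  · rintro ⟨l, i, hi, rfl⟩
    exact (hmem l i).1 hi
  · intro hp
    obtain ⟨u, hu⟩ := exists_of_wordProd_ne_zero hL.2.1
    have hp1 : p.1 ∈ u.map fun i : Fin n ↦ (i : ℕ) + 1 := by
      rw [hu]; exact List.mem_map.2 ⟨p, hp, rfl⟩
    obtain ⟨j, -, hj⟩ := List.mem_map.1 hp1
    have hjn := j.2
    -- the index is negative exactly if the recording letter is primed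
    have hex : ∃ i : SignedIndex n, recordedLetter (ofLex p.2).1 i = p := by
      obtain ⟨a, l, b⟩ := p
      simp only at hj
      cases b with
      | false =>
        refine ⟨⟨-(a : ℤ), by constructor <;> omega⟩, ?_⟩
        unfold recordedLetter
        simp only [Int.natAbs_neg, Int.natAbs_natCast]
        rw [if_pos (by omega)]
        rfl
      | true =>
        refine ⟨⟨(a : ℤ), by constructor <;> omega⟩, ?_⟩
        unfold recordedLetter
        simp only [Int.natAbs_natCast]
        rw [if_neg (by omega)]
        rfl
    obtain ⟨i, hi⟩ := hex
    exact ⟨_, i, (hmem _ i).2 (by rwa [hi]), hi⟩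

lemma count_recordedWord {n k : ℕ} (v : Fin k → List (SignedIndex n)) (l : Fin k)
    (q : PrimedLetter k) (hq : (ofLex q).1 = l) :
    ((recordedWord v).map Prod.snd).count q =
      (v l).countP fun i ↦ (recordedLetter l i).2 = q := by
  rw [recordedWord_eq, List.map_flatten, List.count_flatten, List.map_map, List.map_ofFn,
    List.sum_ofFn, Finset.sum_eq_single l]
  · simp only [Function.comp_apply, List.map_map, List.count, List.countP_map]
    refine List.countP_congr fun i _ ↦ by simp
  · intro l' _ hl'
    simp only [Function.comp_apply, List.map_map, List.count_eq_zero, List.mem_map, not_exists,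
      not_and]
    rintro i - rfl
    apply hl'
    rw [← hq]
    unfold recordedLetter
    split_ifs <;> rfl
  · simp

lemma mem_RSIF_iff {n k : ℕ} {w : (CoxeterMatrix.A n).Group} {v : Fin k → List (SignedIndex n)} :
    v ∈ RSIF n k (inclAC n w) ↔ (∀ l, (v l).Pairwise (· < ·)) ∧ IsRecordedWord n (recordedWord v) ∧
      wordProd n ((recordedWord v).map Prod.fst) = w := by
  rw [RSIF, Set.mem_ofPred_eq, isReducedWord_signedGen_iff, ← map_fst_recordedWord, IsRecordedWord]
  constructor
  · rintro ⟨⟨h1, h2⟩, h3⟩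
    exact ⟨h3, ⟨recordedWord_pairwise h3, h1⟩, h2⟩
  · rintro ⟨h3, ⟨-, h1⟩, h2⟩
    exact ⟨⟨h1, h2⟩, h3⟩

lemma isEGTableau_iff {n : ℕ} {w : (CoxeterMatrix.A n).Group} {P : List (List ℕ)} :
    IsEGTableau n w P ↔
      IsStrictTableau P ∧ IsRed n (readingWord P) ∧ wordProd n (readingWord P) = w := by
  -- in the definition, the word `u` is coerced to `List ℕ` by a monadic map
  simp only [IsEGTableau, bind_pure_comp, List.map_eq_map, List.map_map, Function.comp_def]
  rw [exists_isReducedWord_iff, isStrictTableau_iff]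
  tauto

end PrimedEG

theorem mainTheorem2 (n k : ℕ) (w : (CoxeterMatrix.A n).Group) :
    Set.BijOn (PrimedEG.primedRecordingEG (n := n) (k := k))
      (PrimedEG.RSIF n k (PrimedEG.inclAC n w))
      {T | PrimedEG.IsEGTableau n w T.1 ∧ PrimedEG.IsPrimedTableau k T.2 ∧
        PrimedEG.shape T.2 = PrimedEG.shape T.1} ∧
    ∀ v ∈ PrimedEG.RSIF n k (PrimedEG.inclAC n w),
      PrimedEG.tableauDoubleWeight (PrimedEG.primedRecordingEG v).2 =
        PrimedEG.factorizationDoubleWeight v := by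
  open PrimedEG in
  refine ⟨⟨fun v hv ↦ ?_, fun v hv v' hv' h ↦ ?_, ?_⟩, fun v hv ↦ ?_⟩
  · obtain ⟨-, h2, h3⟩ := mem_RSIF_iff.1 hv
    obtain ⟨g1, g2⟩ := insertWord_fst_spec h2.2
    exact ⟨isEGTableau_iff.2 ⟨g1, isRed_insertWord h2.2, g2.trans h3⟩, (insertWord_snd_spec h2).1,
      shape_insertWord _⟩
  · obtain ⟨h1, h2, -⟩ := mem_RSIF_iff.1 hv
    obtain ⟨h1', h2', -⟩ := mem_RSIF_iff.1 hv'
    exact recordedWord_injective h1 h1' (insertWord_injective h2 h2' h)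
  · rintro ⟨P, Q⟩ ⟨hP, hQ, hs⟩
    obtain ⟨g1, g2, g3⟩ := isEGTableau_iff.1 hP
    obtain ⟨L, hL, he⟩ := exists_insertWord_eq g1 g2 hQ hs
    obtain ⟨v, hv, rfl⟩ := exists_recordedWord_eq hL
    refine ⟨v, mem_RSIF_iff.2 ⟨hv, hL, ?_⟩, he⟩
    rw [← (insertWord_fst_spec hL.2).2, he]
    exact g3
  · have hc := fun q ↦ (insertWord_snd_flatten_perm (recordedWord v)).count_eq q
    refine Prod.ext (funext fun l ↦ ?_) (funext fun l ↦ ?_)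
    · refine (hc (primed l)).trans ((count_recordedWord v l _ rfl).trans ?_)
      refine List.countP_congr fun i _ ↦ ?_
      by_cases hi : i.1 < 0 <;> simp [recordedLetter, hi, primed, unprimed]
    · refine (hc (unprimed l)).trans ((count_recordedWord v l _ rfl).trans ?_)
      refine List.countP_congr fun i _ ↦ ?_
      by_cases hi : i.1 < 0 <;> simp [recordedLetter, hi, primed, unprimed]; omega
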